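/- Let $X$ be a simplicial set with face operators $\partial_k$ and degeneracy operators $s_k$. For a simplicial set $Y$ let $C^N_*(Y)$ be the normalized chains with $\mathbb Z_2$ coefficients (the free module on the simplices modulo the degenerate ones), and let $C^n(X;\mathbb Z_2)=\mathrm{Hom}(C^N_n(X),\mathbb Z_2)$, with $\langle c,x\rangle=0$ whenever the degrees of $c$ and $x$ differ. For $m$-simplices $a,b$ of $X$ put $$AW(a\times b)=\sum_{k=0}^m \partial_{k+1}\cdots\partial_m a\otimes\partial_0\cdots\partial_{k-1}b,$$ $$SHI(a\times b)=\sum (-1)^{\bar m+\mathrm{sig}(\alpha,\beta)+1}\, s_{\beta_q+\bar m}\cdots s_{\beta_1+\bar m}s_{\bar m-1}\partial_{m-q+1}\cdots\partial_m a\times s_{\alpha_{p+1}+\bar m}\cdots s_{\alpha_1+\bar m}\partial_{\bar m}\cdots\partial_{m-q-1}b,$$ where the last sum is over $0\le q\le m-1$, $0\le p\le m-q-1$ and all partitions of $\{0,\dots,p+q\}$ into $\alpha_1<\dots<\alpha_{p+1}$ and $\beta_1<\dots<\beta_q$, with $\bar m=m-p-q$ and $\mathrm{sig}(\alpha,\beta)=\sum_{k=1}^{p+1}(\alpha_k-(k-1))$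 (over $\mathbb Z_2$ the sign plays no role). These induce operators $AW:C^N_*(X\times X)\to C^N_*(X)\otimes C^N_*(X)$ and $SHI:C^N_*(X\times X)\to C^N_{*+1}(X\times X)$. Let $t(a,b)=(b,a)$, let $\Delta:C^N_*(X)\to C^N_*(X\times X)$ be the linear map with $\Delta(x)=(x,x)$ on simplices, and let $\mu$ be the multiplication of $\mathbb Z_2$. For $i,j\ge 0$ and $c\in C^j(X;\mathbb Z_2)$ define the cochain $Sq^i(c)\in C^{i+j}(X;\mathbb Z_2)$ by $$Sq^i(c)(x)=\begin{cases}\mu\langle c\otimes c,\,AW(t\,SHI)^{j-i}\Delta(x)\rangle,& i\le j,\\ 0,& i>j.\end{cases}$$ Put $m=i+j$ and, for $i\le j$, $n=j-i$. Then $Sq^i(c)=0$ if $i>j$. If $i\le j$, then $Sq^i(c)$ is the linear functional on $C^N_m(X)$ whose value at (the class of) an arbitrary $m$-simplex $x$ is given as follows. If $m$ is even, $$Sq^i(c)(x)=\sum_{i_n=S(n)}^{m}\ \sum_{i_{n-1}=S(n-1)}^{i_n-1}\cdots\sum_{i_1=S(1)}^{i_2-1}\langle c,\partial_{i_0+1}\cdots\partial_{i_1-1}\,\partial_{i_2+1}\cdots\partial_{i_{n-1}-1}\,\partial_{i_n+1}\cdots\partial_m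 x\rangle\cdot\langle c,\partial_0\cdots\partial_{i_0-1}\,\partial_{i_1+1}\cdots\partial_{i_{n-2}-1}\,\partial_{i_{n-1}+1}\cdots\partial_{i_n-1}x\rangle ;$$ if $m$ is odd, $$Sq^i(c)(x)=\sum_{i_n=S(n)}^{m}\ \sum_{i_{n-1}=S(n-1)}^{i_n-1}\cdots\sum_{i_1=S(1)}^{i_2-1}\langle c,\partial_{i_0+1}\cdots\partial_{i_1-1}\,\partial_{i_2+1}\cdots\partial_{i_{n-2}-1}\,\partial_{i_{n-1}+1}\cdots\partial_{i_n-1}x\rangle\cdot\langle c,\partial_0\cdots\partial_{i_0-1}\,\partial_{i_1+1}\cdots\partial_{i_{n-1}-1}\,\partial_{i_n+1}\cdots\partial_m x\rangle .$$ Here $$S(k)=i_{k+1}-i_{k+2}+\cdots+(-1)^{k+n-1}i_n+(-1)^{k+n}\Big\lfloor\frac{m+1}{2}\Big\rfloor+\Big\lfloor\frac k2\Big\rfloor\qquad(0\le k\le n),\qquad i_0=S(0).$$ A sum whose upper limit is below its lower limit is $0$; each block $\partial_a\cdots\partial_b$ consists of consecutive increasing indices, and is empty if $b<a$. The blocks $\partial_{i_k+1}\cdots\partial_{i_{k+1}-1}$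 (with $i_{n+1}=m+1$) lie in the first factor for $k$ even and in the second factor for $k$ odd, and $\partial_0\cdots\partial_{i_0-1}$ lies in the second factor. For $n=0$ there is a single summand, with $i_0=m/2$. -/

import Mathlib

open CategoryTheory MonoidalCategory
open scoped Simplicial TensorProduct

universe u

noncomputable section

namespace SteenrodSquare

/-! ### Simplices and words in the face and degeneracy operators -/

/-- The simplices of all degrees of a simplicial set. -/
abbrev Simplex (X : SSet.{u}) : Type u := Σ n : ℕ, X _⦋n⦌

/-- The face operator `∂ₖ`. It is only meaningful on simplices of degree `n ≥ 1` and for `k ≤ n`;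
otherwise it does nothing. -/
def face {X : SSet.{u}} (k : ℕ) (s : Simplex X) : Simplex X :=
  match s with
  | ⟨0, x⟩ => ⟨0, x⟩
  | ⟨n + 1, x⟩ => if h : k < n + 2 then ⟨n, X.δ ⟨k, h⟩ x⟩ else ⟨n + 1, x⟩

/-- The degeneracy operator `sₖ`. It is only meaningful on simplices of degree `n ≥ k`;
otherwise it does nothing. -/
def degen {X : SSet.{u}} (k : ℕ) (s : Simplex X) : Simplex X :=
  match s with
  | ⟨n, x⟩ => if h : k < n + 1 then ⟨n + 1, X.σ ⟨k, h⟩ x⟩ else ⟨n, x⟩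

/-- `faces [k₁, …, kᵣ] s = ∂_{k₁} ⋯ ∂_{kᵣ} s` (the last operator of the list acts first). -/
def faces {X : SSet.{u}} (w : List ℕ) (s : Simplex X) : Simplex X := w.foldr face s

/-- `degens [k₁, …, kᵣ] s = s_{k₁} ⋯ s_{kᵣ} s` (the last operator of the list acts first). -/
def degens {X : SSet.{u}} (w : List ℕ) (s : Simplex X) : Simplex X := w.foldr degen s

/-! ### Normalized chains and cochains -/

section Chains

variable (R : Type) [CommRing R]

/-- The span of the degenerate `n`-simplices in the free module on all `n`-simplices. -/
def degenerateChains (X : SSet.{u}) (n : ℕ) : Submodule R (X _⦋n⦌ →₀ R) :=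
  Submodule.span R ((fun x => Finsupp.single x 1) '' X.degenerate n)

/-- The module `C_n^N(X)` of normalized `n`-chains. -/
def NChain (X : SSet.{u}) (n : ℕ) : Type u :=
  (X _⦋n⦌ →₀ R) ⧸ degenerateChains R X n

instance (X : SSet.{u}) (n : ℕ) : AddCommGroup (NChain R X n) :=
  inferInstanceAs (AddCommGroup ((X _⦋n⦌ →₀ R) ⧸ degenerateChains R X n))

instance (X : SSet.{u}) (n : ℕ) : Module R (NChain R X n) :=
  inferInstanceAs (Module R ((X _⦋n⦌ →₀ R) ⧸ degenerateChains R X n))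

/-- The normalized chain represented by a chain. -/
def NChain.mk (X : SSet.{u}) (n : ℕ) : (X _⦋n⦌ →₀ R) →ₗ[R] NChain R X n :=
  (degenerateChains R X n).mkQ

/-- The module `C^n(X; R)` of normalized `n`-cochains. -/
abbrev NCochain (X : SSet.{u}) (n : ℕ) : Type u := NChain R X n →ₗ[R] R

variable {R}

lemma NChain.mk_single_eq_zero {X : SSet.{u}} {n : ℕ} {x : X _⦋n⦌} (hx : x ∈ X.degenerate n) :
    NChain.mk R X n (Finsupp.single x 1) = 0 :=
  (Submodule.Quotient.mk_eq_zero _).2 (Submodule.subset_span ⟨x, hx, rfl⟩)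

/-- The linear map on normalized chains with given values on the simplices. -/
def NChain.desc {X : SSet.{u}} {n : ℕ} {M : Type*} [AddCommGroup M] [Module R M]
    (f : X _⦋n⦌ → M) (hf : ∀ x ∈ X.degenerate n, f x = 0) : NChain R X n →ₗ[R] M :=
  (degenerateChains R X n).liftQ (Finsupp.linearCombination R f) (by
    rw [degenerateChains, Submodule.span_le]
    rintro _ ⟨x, hx, rfl⟩
    simp [hf x hx])

lemma NChain.desc_mk_single {X : SSet.{u}} {n : ℕ} {M : Type*} [AddCommGroup M] [Module R M]
    (f : X _⦋n⦌ → M) (hf : ∀ x ∈ X.degenerate n, f x = 0) (x : X _⦋n⦌) (r : R) :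
    NChain.desc f hf (NChain.mk R X n (Finsupp.single x r)) = r • f x :=
  (Submodule.liftQ_apply _ _ _).trans (Finsupp.linearCombination_single R r x)

/-- The class of a simplex in the normalized `n`-chains, with value `0` if its degree is not `n`. -/
def cls {X : SSet.{u}} (n : ℕ) (s : Simplex X) : NChain R X n :=
  if h : s.1 = n then NChain.mk R X n (Finsupp.single (h ▸ s.2) 1) else 0

/-- The value `⟨c, s⟩` of an `n`-cochain at a simplex, with the convention that it is `0` if the
degree of `s` is not `n`. -/
def ev {X : SSet.{u}} {n : ℕ} (c : NCochain R X n) (s : Simplex X) : R := c (cls n s)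

/-- The class of the simplex `s × s'` of the product in the normalized `n`-chains, for `s` and `s'`
of degree `n`; by convention `0` otherwise. -/
def crossCls {X Y : SSet.{u}} (n : ℕ) (s : Simplex X) (s' : Simplex Y) : NChain R (X ⊗ Y) n :=
  if h : s.1 = n ∧ s'.1 = n then
    NChain.mk R (X ⊗ Y) n
      (Finsupp.single (show (X ⊗ Y) _⦋n⦌ from (⟨h.1 ▸ s.2, h.2 ▸ s'.2⟩ : X _⦋n⦌ × Y _⦋n⦌)) 1)
  else 0

/-- The degree `m` part of `C_*^N(X) ⊗ C_*^N(Y)`: the finite direct sum of the modules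
`C_i^N(X) ⊗ C_l^N(Y)` over all `(i, l)` with `i + l = m`. -/
abbrev TensorChain (R : Type) [CommRing R] (X Y : SSet.{u}) (m : ℕ) : Type u :=
  (d : {d : ℕ × ℕ // d.1 + d.2 = m}) → NChain R X d.1.1 ⊗[R] NChain R Y d.1.2

end Chains

/-! ### Auxiliary facts: the operators below send degenerate simplices to zero -/

section Aux

variable {X Y : SSet.{u}}

/-- `s` is obtained from `r` by a simplicial operator which on vertices is given by `f`. -/
def IsPull (r : Simplex X) (f : ℕ → ℕ) (s : Simplex X) : Prop :=
  ∃ g : ⦋s.1⦌ ⟶ ⦋r.1⦌, s.2 = X.map g.op r.2 ∧ ∀ v : Fin (s.1 + 1), (g.toOrderHom v : ℕ) = f v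

lemma isPull_refl (r : Simplex X) : IsPull r id r := ⟨𝟙 _, by simp, fun _ => rfl⟩

lemma IsPull.congr {r s : Simplex X} {f f' : ℕ → ℕ} (h : IsPull r f s)
    (hf : ∀ v ≤ s.1, f v = f' v) : IsPull r f' s := by
  obtain ⟨g, h1, h2⟩ := h
  exact ⟨g, h1, fun v => by rw [h2, hf _ (by omega)]⟩

lemma IsPull.face {r s : Simplex X} {f : ℕ → ℕ} (h : IsPull r f s) {k : ℕ} (h0 : 0 < s.1)
    (hk : k ≤ s.1) : (face k s).1 + 1 = s.1 ∧
      IsPull r (fun v => f (if v < k then v else v + 1)) (face k s) := by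
  obtain ⟨n, x⟩ := s
  obtain _ | n := n
  · simp at h0
  obtain ⟨g, h1, h2⟩ := h
  dsimp only at *
  have hk' : k < n + 2 := by omega
  simp only [SteenrodSquare.face, hk', dite_true, true_and]
  refine ⟨SimplexCategory.δ ⟨k, hk'⟩ ≫ g, ?_, fun v => ?_⟩
  · simp [h1, SimplicialObject.δ]
  · have := h2 ((SimplexCategory.δ ⟨k, hk'⟩).toOrderHom v)
    refine this.trans ?_
    congr 1
    change ((Fin.succAbove ⟨k, hk'⟩ v : Fin (n + 2)) : ℕ) = _
    rw [Fin.succAbove]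
    simp only [Fin.lt_def]
    split_ifs <;> simp_all

lemma IsPull.degen {r s : Simplex X} {f : ℕ → ℕ} (h : IsPull r f s) {k : ℕ}
    (hk : k ≤ s.1) : (degen k s).1 = s.1 + 1 ∧
      IsPull r (fun v => f (if v ≤ k then v else v - 1)) (degen k s) := by
  obtain ⟨n, x⟩ := s
  obtain ⟨g, h1, h2⟩ := h
  dsimp only at *
  have hk' : k < n + 1 := by omega
  simp only [SteenrodSquare.degen, hk', dite_true, true_and]
  refine ⟨SimplexCategory.σ ⟨k, hk'⟩ ≫ g, ?_, fun v => ?_⟩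
  · simp [h1, SimplicialObject.σ]
  · have := h2 ((SimplexCategory.σ ⟨k, hk'⟩).toOrderHom v)
    refine this.trans ?_
    congr 1
    change ((Fin.predAbove ⟨k, hk'⟩ v : Fin (n + 1)) : ℕ) = _
    rw [Fin.predAbove]
    simp only [Fin.lt_def, Fin.val_castSucc]
    split_ifs <;> simp_all <;> omega

lemma IsPull.faces_Ico {r s : Simplex X} {f : ℕ → ℕ} (h : IsPull r f s) {a b : ℕ} (hab : a ≤ b)
    (hb : b ≤ s.1 + 1) (h0 : b - a ≤ s.1) : (faces (List.Ico a b) s).1 + (b - a) = s.1 ∧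
      IsPull r (fun v => f (if v < a then v else v + (b - a))) (faces (List.Ico a b) s) := by
  obtain ⟨l, rfl⟩ := Nat.exists_eq_add_of_le hab
  induction l generalizing a with
  | zero => simpa [faces] using h.congr (by simp)
  | succ l ih =>
    have e : List.Ico a (a + (l + 1)) = a :: List.Ico (a + 1) (a + 1 + l) := by
      rw [List.Ico.eq_cons (by omega)]
      congr 2
      omega
    obtain ⟨i1, i2⟩ := ih (a := a + 1) (by omega) (by omega) (by omega)
    obtain ⟨j1, j2⟩ := i2.face (k := a) (by omega) (by omega)
    rw [e]
    refine ⟨?_, j2.congr fun v _ => ?_⟩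
    · change (SteenrodSquare.face a (faces (List.Ico (a + 1) (a + 1 + l)) s)).1 + _ = _
      omega
    · congr 1
      split_ifs <;> omega

lemma IsPull.degens_sorted {r s : Simplex X} {f : ℕ → ℕ} (h : IsPull r f s) (w : List ℕ)
    (hw : w.Pairwise (· > ·)) (hb : ∀ b ∈ w, b < s.1 + w.length) :
    (degens w s).1 = s.1 + w.length ∧
      IsPull r (fun v => f (v - (w.filter (· < v)).length)) (degens w s) := by
  induction w with
  | nil => simpa [degens] using h.congr (by simp)
  | cons b w ih =>
    rw [List.pairwise_cons] at hw
    have hb0 := hb b (by simp)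
    simp only [List.length_cons] at hb0
    obtain ⟨i1, i2⟩ := ih hw.2 (fun b' hb' => by have := hw.1 b' hb'; omega)
    obtain ⟨j1, j2⟩ := i2.degen (k := b) (by omega)
    refine ⟨?_, j2.congr fun v _ => ?_⟩
    · change (SteenrodSquare.degen b (degens w s)).1 = _
      simp only [List.length_cons]
      omega
    · congr 1
      by_cases hv : v ≤ b
      · simp [hv, show ¬ b < v by omega]
      · have e1 : w.filter (· < v) = w := by
          rw [List.filter_eq_self]
          intro c hc
          have := hw.1 c hc
          simp only [decide_eq_true_eq]; omega
        have e2 : w.filter (· < v - 1) = w := by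
          rw [List.filter_eq_self]
          intro c hc
          have := hw.1 c hc
          simp only [decide_eq_true_eq]; omega
        simp only [if_neg hv, e2, List.filter_cons, show b < v by omega, decide_true, if_true, e1,
          List.length_cons]
        omega

/-- If a vertex map sends `v` and `v + 1` to `k` and `k + 1`, then the operator factors through
the degeneracy `s_v` on simplices of the form `s_k a`. -/
lemma IsPull.exists_σ {n k N v : ℕ} (hk : k < n + 1) (a : X _⦋n⦌) {f : ℕ → ℕ} {x : X _⦋N + 1⦌}
    (h : IsPull ⟨n + 1, X.σ ⟨k, hk⟩ a⟩ f ⟨N + 1, x⟩) (hv : v < N + 1)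
    (hf : f v = f (v + 1) ∨ f v = k ∧ f (v + 1) = k + 1) :
    ∃ a', x = X.σ ⟨v, hv⟩ a' := by
  obtain ⟨g, h1, h2⟩ := h
  dsimp only at g h1 h2
  have key : ((g ≫ SimplexCategory.σ ⟨k, hk⟩).toOrderHom (Fin.castSucc ⟨v, hv⟩)) =
      (g ≫ SimplexCategory.σ ⟨k, hk⟩).toOrderHom (Fin.succ ⟨v, hv⟩) := by
    have a1 := h2 (Fin.castSucc ⟨v, hv⟩)
    have a2 := h2 (Fin.succ ⟨v, hv⟩)
    simp only [Fin.val_castSucc, Fin.val_succ] at a1 a2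
    change Fin.predAbove ⟨k, hk⟩ (g.toOrderHom (Fin.castSucc ⟨v, hv⟩)) =
      Fin.predAbove ⟨k, hk⟩ (g.toOrderHom (Fin.succ ⟨v, hv⟩))
    rcases hf with hf | ⟨hf, hf'⟩
    · congr 1
      apply Fin.ext
      omega
    · have b1 : g.toOrderHom (Fin.castSucc ⟨v, hv⟩) = Fin.castSucc ⟨k, hk⟩ := by
        apply Fin.ext; simp only [Fin.val_castSucc]; omega
      have b2 : g.toOrderHom (Fin.succ ⟨v, hv⟩) = Fin.succ ⟨k, hk⟩ := by
        apply Fin.ext; simp only [Fin.val_succ]; omega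
      rw [b1, b2, Fin.predAbove_castSucc_self, Fin.predAbove_succ_self]
  obtain ⟨θ, hθ⟩ := SimplexCategory.eq_σ_comp_of_not_injective' _ _ key
  refine ⟨X.map θ.op a, ?_⟩
  rw [h1]
  simp only [SimplicialObject.σ]
  rw [← ConcreteCategory.comp_apply, ← ConcreteCategory.comp_apply, ← X.map_comp, ← X.map_comp,
    ← op_comp, ← op_comp, hθ]

lemma cls_eq_zero {R : Type} [CommRing R] {n k m : ℕ} (hk : k < n + 1) (a : X _⦋n⦌) {f : ℕ → ℕ}
    {s : Simplex X} (h : IsPull ⟨n + 1, X.σ ⟨k, hk⟩ a⟩ f s) {v : ℕ} (hv : v < s.1)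
    (hf : f v = f (v + 1) ∨ f v = k ∧ f (v + 1) = k + 1) : cls (R := R) m s = 0 := by
  unfold cls
  split_ifs with h1
  · obtain ⟨N, x⟩ := s
    dsimp only at h1 hv
    subst h1
    obtain _ | N := N
    · simp at hv
    obtain ⟨a', rfl⟩ := h.exists_σ hk a hv hf
    exact NChain.mk_single_eq_zero (SSet.σ_mem_degenerate _ _ _)
  · rfl

lemma crossCls_eq_zero {R : Type} [CommRing R] {n k m : ℕ} (hk : k < n + 1) (a : X _⦋n⦌)
    (b : Y _⦋n⦌) {f g : ℕ → ℕ} {s : Simplex X} {s' : Simplex Y}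
    (h : IsPull ⟨n + 1, X.σ ⟨k, hk⟩ a⟩ f s) (h' : IsPull ⟨n + 1, Y.σ ⟨k, hk⟩ b⟩ g s')
    {v : ℕ} (hv : v < m) (hf : f v = f (v + 1) ∨ f v = k ∧ f (v + 1) = k + 1)
    (hg : g v = g (v + 1) ∨ g v = k ∧ g (v + 1) = k + 1) :
    crossCls (R := R) m s s' = 0 := by
  unfold crossCls
  split_ifs with h1
  · obtain ⟨N, x⟩ := s
    obtain ⟨N', x'⟩ := s'
    obtain ⟨h1, h2⟩ := h1
    dsimp only at h1 h2
    subst h1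
    subst h2
    obtain _ | N := N'
    · simp at hv
    obtain ⟨a', rfl⟩ := h.exists_σ hk a hv hf
    obtain ⟨b', rfl⟩ := h'.exists_σ hk b hv hg
    exact NChain.mk_single_eq_zero (SSet.σ_mem_degenerate (X ⊗ Y) ⟨v, hv⟩
      (show (X ⊗ Y) _⦋N⦌ from (⟨a', b'⟩ : X _⦋N⦌ × Y _⦋N⦌)))
  · rfl

/-- A degenerate simplex of a product has components which are degenerate in the same way. -/
lemma exists_of_mem_degenerate {m : ℕ} {z : (X ⊗ Y) _⦋m⦌} (hz : z ∈ (X ⊗ Y).degenerate m) :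
    ∃ (n k : ℕ) (hk : k < n + 1) (a : X _⦋n⦌) (b : Y _⦋n⦌), m = n + 1 ∧
      (⟨m, z.1⟩ : Simplex X) = ⟨n + 1, X.σ ⟨k, hk⟩ a⟩ ∧
      (⟨m, z.2⟩ : Simplex Y) = ⟨n + 1, Y.σ ⟨k, hk⟩ b⟩ := by
  obtain _ | n := m
  · rw [SSet.degenerate_zero] at hz
    exact hz.elim
  rw [SSet.degenerate_eq_iUnion_range_σ] at hz
  obtain ⟨⟨k, hk⟩, y, rfl⟩ := Set.mem_iUnion.1 hz
  exact ⟨n, k, hk, y.1, y.2, rfl, rfl, rfl⟩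

end Aux

/-! ### The Eilenberg–Zilber operators -/

/-- For `s = {s₁ < ⋯ < sᵣ}`, the list `[sᵣ + a, …, s₁ + a]`. -/
def shiftDesc (s : Finset ℕ) (a : ℕ) : List ℕ := ((s.sort (· ≤ ·)).reverse).map (· + a)

section Aux

lemma length_filter_shiftDesc (s : Finset ℕ) (a v : ℕ) :
    ((shiftDesc s a).filter (· < v)).length = (s.filter (· + a < v)).card := by
  rw [shiftDesc, List.filter_map, List.length_map, List.filter_reverse, List.length_reverse,
    Finset.card_def, Finset.filter_val, ← Finset.sort_eq s (· ≤ ·), Multiset.filter_coe]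
  rfl

lemma length_shiftDesc (s : Finset ℕ) (a : ℕ) : (shiftDesc s a).length = s.card := by
  simp [shiftDesc]

lemma pairwise_shiftDesc (s : Finset ℕ) (a : ℕ) : (shiftDesc s a).Pairwise (· > ·) := by
  rw [shiftDesc, List.pairwise_map, List.pairwise_reverse]
  refine (s.sortedLT_sort.pairwise).imp ?_
  intro x y h
  omega

lemma mem_shiftDesc {s : Finset ℕ} {a x : ℕ} : x ∈ shiftDesc s a ↔ ∃ b ∈ s, b + a = x := by
  simp [shiftDesc]

lemma exists_card_filter_lt (s : Finset ℕ) {i : ℕ} (hi : i < s.card) :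
    ∃ a ∈ s, (s.filter (· < a)).card = i := by
  have hf : Set.Finite {x | x ∈ s} := s.finite_toSet
  have hc : hf.toFinset = s := by ext x; simp
  have hi' : i < hf.toFinset.card := hc.symm ▸ hi
  refine ⟨Nat.nth (· ∈ s) i, Nat.nth_mem_of_lt_card hf hi', ?_⟩
  have := Nat.count_nth (p := (· ∈ s)) (n := i) (fun _ => hi')
  rw [Nat.count_eq_card_filter_range] at this
  refine Eq.trans ?_ this
  congr 1
  ext x
  simp [and_comm]

lemma card_filter_sdiff {N : ℕ} {s : Finset ℕ} (hs : s ⊆ Finset.range N) {v : ℕ} (hv : v ≤ N) :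
    ((Finset.range N \ s).filter (· < v)).card + (s.filter (· < v)).card = v := by
  rw [← Finset.card_union_of_disjoint]
  · conv_rhs => rw [← Finset.card_range v]
    congr 1
    ext x
    have := @hs x
    simp only [Finset.mem_range] at this
    simp only [Finset.mem_union, Finset.mem_filter, Finset.mem_sdiff, Finset.mem_range]
    by_cases x ∈ s <;> simp_all
    omega
  · refine Finset.disjoint_left.2 fun x hx hx' => ?_
    simp only [Finset.mem_filter, Finset.mem_sdiff] at hx hx'
    exact hx.1.2 hx'.1

lemma card_filter_lt_succ (s : Finset ℕ) (v : ℕ) :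
    (s.filter (· < v + 1)).card = (s.filter (· < v)).card + if v ∈ s then 1 else 0 := by
  have : s.filter (· < v + 1) = s.filter (· < v) ∪ s.filter (· = v) := by
    ext x
    simp only [Finset.mem_union, Finset.mem_filter, ← and_or_left, Nat.lt_succ_iff_lt_or_eq]
  rw [this, Finset.card_union_of_disjoint, Finset.filter_eq']
  · split_ifs <;> simp
  · refine Finset.disjoint_left.2 fun x hx hx' => ?_
    simp only [Finset.mem_filter] at hx hx'
    omega

end Aux

/-- The signature `∑ₖ (αₖ - (k - 1))` of the shuffle whose first part is `α = {α₁ < α₂ < ⋯}`. -/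
def shuffleSig (α : Finset ℕ) : ℕ := ∑ a ∈ α, a - ∑ k ∈ Finset.range α.card, k

section Operators

variable {R : Type} [CommRing R]

/-- The summand of `AW(a × b)` in bidegree `d = (i, m - i)`:
`∂_{i+1} ⋯ ∂_m a ⊗ ∂_0 ⋯ ∂_{i-1} b`. -/
def awTerm (R : Type) [CommRing R] {X Y : SSet.{u}} {m : ℕ} (z : (X ⊗ Y) _⦋m⦌) (d : ℕ × ℕ) :
    NChain R X d.1 ⊗[R] NChain R Y d.2 :=
  cls d.1 (faces (List.Ico (d.1 + 1) (m + 1)) ⟨m, z.1⟩) ⊗ₜ[R]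
    cls d.2 (faces (List.Ico 0 d.1) ⟨m, z.2⟩)

/-- The simplex occurring in the summand of `SHI(a × b)` with indices `q`, `p` and
`(α, β)`, where `β` is the complement of `α` in `{0, …, p + q}`:
`s_{β_q+m̄} ⋯ s_{β_1+m̄} s_{m̄-1} ∂_{m-q+1} ⋯ ∂_m a × s_{α_{p+1}+m̄} ⋯ s_{α_1+m̄} ∂_m̄ ⋯ ∂_{m-q-1} b`
with `m̄ = m - p - q`. -/
def shiTerm (R : Type) [CommRing R] {X Y : SSet.{u}} {m : ℕ} (z : (X ⊗ Y) _⦋m⦌) (q p : ℕ)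
    (α : Finset ℕ) : NChain R (X ⊗ Y) (m + 1) :=
  crossCls (m + 1)
    (degens (shiftDesc (Finset.range (p + q + 1) \ α) (m - p - q))
      (degen (m - p - q - 1) (faces (List.Ico (m - q + 1) (m + 1)) ⟨m, z.1⟩)))
    (degens (shiftDesc α (m - p - q)) (faces (List.Ico (m - p - q) (m - q)) ⟨m, z.2⟩))

lemma awTerm_eq_zero {X Y : SSet.{u}} {m : ℕ} (z : (X ⊗ Y) _⦋m⦌)
    (hz : z ∈ (X ⊗ Y).degenerate m) (d : ℕ × ℕ) (hd : d.1 + d.2 = m) : awTerm R z d = 0 := by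
  obtain ⟨i, l⟩ := d
  obtain ⟨n, k, hk, a, b, hm, e1, e2⟩ := exists_of_mem_degenerate hz
  dsimp only at hd
  unfold awTerm
  dsimp only
  rw [e1, e2]
  by_cases hki : k + 1 ≤ i
  · obtain ⟨h1, h2⟩ := (isPull_refl (⟨n + 1, X.σ ⟨k, hk⟩ a⟩ : Simplex X)).faces_Ico
      (a := i + 1) (b := m + 1) (by omega) (by dsimp only; omega) (by dsimp only; omega)
    dsimp only at h1
    rw [cls_eq_zero hk a h2 (v := k) (by omega) (Or.inr ?_), TensorProduct.zero_tmul]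
    constructor <;> dsimp only [id] <;> split_ifs <;> omega
  · obtain ⟨h1, h2⟩ := (isPull_refl (⟨n + 1, Y.σ ⟨k, hk⟩ b⟩ : Simplex Y)).faces_Ico
      (a := 0) (b := i) (by omega) (by dsimp only; omega) (by dsimp only; omega)
    dsimp only at h1
    rw [cls_eq_zero (s := faces (List.Ico 0 i) _) hk b h2 (v := k - i) (by omega) (Or.inr ?_),
      TensorProduct.tmul_zero]
    constructor <;> dsimp only [id] <;> split_ifs <;> omega

lemma shiTerm_eq_zero {X Y : SSet.{u}} {m : ℕ} (z : (X ⊗ Y) _⦋m⦌)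
    (hz : z ∈ (X ⊗ Y).degenerate m) {q p : ℕ} (hq : q < m) (hp : p < m - q) {α : Finset ℕ}
    (hα : α ∈ (Finset.range (p + q + 1)).powersetCard (p + 1)) : shiTerm R z q p α = 0 := by
  obtain ⟨n, k, hk, a, b, hm, e1, e2⟩ := exists_of_mem_degenerate hz
  obtain ⟨hα, hc⟩ := Finset.mem_powersetCard.1 hα
  have hβc : (Finset.range (p + q + 1) \ α).card = q := by
    rw [Finset.card_sdiff_of_subset hα, hc, Finset.card_range]; omega
  have hβ : Finset.range (p + q + 1) \ α ⊆ Finset.range (p + q + 1) := Finset.sdiff_subset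
  have hmem : ∀ x, x < p + q + 1 → (x ∈ Finset.range (p + q + 1) \ α ↔ x ∉ α) := by
    intro x hx; simp [hx]
  have hsum : ∀ v, v ≤ p + q + 1 → _ := fun v hv => card_filter_sdiff hα hv
  unfold shiTerm
  rw [e1, e2]
  generalize Finset.range (p + q + 1) \ α = β at *
  obtain ⟨w, rfl⟩ : ∃ w, m = w + 1 + p + q := ⟨m - p - q - 1, by omega⟩
  have hw : w + 1 + p + q - p - q = w + 1 := by omega
  rw [hw]
  obtain ⟨f1, f2⟩ := (isPull_refl (⟨n + 1, X.σ ⟨k, hk⟩ a⟩ : Simplex X)).faces_Ico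
      (a := w + 1 + p + q - q + 1) (b := w + 1 + p + q + 1) (by omega) (by dsimp only; omega)
      (by dsimp only; omega)
  dsimp only at f1
  obtain ⟨f3, f4⟩ := f2.degen (k := w + 1 - 1) (by omega)
  obtain ⟨f5, f6⟩ := f4.degens_sorted (shiftDesc β (w + 1)) (pairwise_shiftDesc _ _) (by
    intro x hx
    obtain ⟨y, hy, rfl⟩ := mem_shiftDesc.1 hx
    have := Finset.mem_range.1 (hβ hy)
    rw [length_shiftDesc]
    omega)
  obtain ⟨g1, g2⟩ := (isPull_refl (⟨n + 1, Y.σ ⟨k, hk⟩ b⟩ : Simplex Y)).faces_Ico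
      (a := w + 1) (b := w + 1 + p + q - q) (by omega) (by dsimp only; omega)
      (by dsimp only; omega)
  dsimp only at g1
  obtain ⟨g3, g4⟩ := g2.degens_sorted (shiftDesc α (w + 1)) (pairwise_shiftDesc _ _) (by
    intro x hx
    obtain ⟨y, hy, rfl⟩ := mem_shiftDesc.1 hx
    have := Finset.mem_range.1 (hα hy)
    rw [length_shiftDesc]
    omega)
  simp only [length_filter_shiftDesc, id] at f6 g4
  have hlow : ∀ (s : Finset ℕ) (v : ℕ), v ≤ w + 1 →
      (s.filter (· + (w + 1) < v)).card = 0 := by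
    intro s v hv
    rw [Finset.card_eq_zero, Finset.filter_eq_empty_iff]
    intro x _; omega
  have hhigh : ∀ (s : Finset ℕ) (v : ℕ),
      (s.filter (· + (w + 1) < v + (w + 1))).card = (s.filter (· < v)).card := by
    intro s v; congr 1; ext x; simp
  by_cases c1 : k < w
  · refine crossCls_eq_zero hk a b f6 g4 (v := k) (by omega) (Or.inr ?_) (Or.inr ?_)
    · rw [hlow _ _ (by omega), hlow _ _ (by omega)]
      constructor <;> split_ifs <;> omega
    · rw [hlow _ _ (by omega), hlow _ _ (by omega)]
      constructor <;> split_ifs <;> omega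
  · by_cases c2 : k < w + 1 + p
    · obtain ⟨y, hy, hy'⟩ := exists_card_filter_lt α (i := k - w) (by omega)
      have hyN := Finset.mem_range.1 (hα hy)
      have s1 := hsum y (by omega)
      have s2 := card_filter_lt_succ α y
      have s3 := card_filter_lt_succ β y
      rw [if_pos hy] at s2
      rw [if_neg (fun h => (hmem y hyN).1 h hy)] at s3
      refine crossCls_eq_zero hk a b f6 g4 (v := y + (w + 1)) (by omega) (Or.inr ?_) (Or.inl ?_)
      · rw [show y + (w + 1) + 1 = (y + 1) + (w + 1) by omega, hhigh, hhigh]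
        constructor <;> split_ifs <;> omega
      · rw [show y + (w + 1) + 1 = (y + 1) + (w + 1) by omega, hhigh, hhigh]
        split_ifs <;> omega
    · obtain ⟨y, hy, hy'⟩ := exists_card_filter_lt β (i := k - (w + 1 + p)) (by omega)
      have hyN := Finset.mem_range.1 (hβ hy)
      have s1 := hsum y (by omega)
      have s2 := card_filter_lt_succ α y
      have s3 := card_filter_lt_succ β y
      rw [if_neg ((hmem y hyN).1 hy)] at s2
      rw [if_pos hy] at s3
      refine crossCls_eq_zero hk a b f6 g4 (v := y + (w + 1)) (by omega) (Or.inl ?_) (Or.inr ?_)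
      · rw [show y + (w + 1) + 1 = (y + 1) + (w + 1) by omega, hhigh, hhigh]
        split_ifs <;> omega
      · rw [show y + (w + 1) + 1 = (y + 1) + (w + 1) by omega, hhigh, hhigh]
        constructor <;> split_ifs <;> omega

/-- The Alexander–Whitney operator `AW : C_m^N(X × Y) → (C_*^N(X) ⊗ C_*^N(Y))_m`. -/
def AW (R : Type) [CommRing R] (X Y : SSet.{u}) (m : ℕ) :
    NChain R (X ⊗ Y) m →ₗ[R] TensorChain R X Y m :=
  NChain.desc (M := TensorChain R X Y m) (fun z d => awTerm R z d.1)
    (fun z hz => funext fun d => awTerm_eq_zero z hz d.1 d.2)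

/-- The Shih operator `SHI : C_m^N(X × Y) → C_{m+1}^N(X × Y)`; the inner sum is over the
`(p+1, q)`-shuffles `(α, β)`. -/
def SHI (R : Type) [CommRing R] (X Y : SSet.{u}) (m : ℕ) :
    NChain R (X ⊗ Y) m →ₗ[R] NChain R (X ⊗ Y) (m + 1) :=
  NChain.desc
    (fun z => ∑ q ∈ Finset.range m, ∑ p ∈ Finset.range (m - q),
      ∑ α ∈ (Finset.range (p + q + 1)).powersetCard (p + 1),
        (-1 : R) ^ (m - p - q + shuffleSig α + 1) • shiTerm R z q p α)
    (fun z hz => Finset.sum_eq_zero fun q hq => Finset.sum_eq_zero fun p hp =>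
      Finset.sum_eq_zero fun α hα => by
        rw [shiTerm_eq_zero z hz (Finset.mem_range.1 hq) (Finset.mem_range.1 hp) hα, smul_zero])

lemma app_mem_degenerate {X Y : SSet.{u}} (f : X ⟶ Y) {n : ℕ} {x : X _⦋n⦌}
    (hx : x ∈ X.degenerate n) : f.app _ x ∈ Y.degenerate n := by
  obtain ⟨m, hm, g, y, rfl⟩ := hx
  exact ⟨m, hm, g, f.app _ y, (NatTrans.naturality_apply f g.op y).symm⟩

/-- The map on normalized chains induced by a map of simplicial sets. -/
def NChain.map (R : Type) [CommRing R] {X Y : SSet.{u}} (f : X ⟶ Y) (n : ℕ) :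
    NChain R X n →ₗ[R] NChain R Y n :=
  NChain.desc (fun x => NChain.mk R Y n (Finsupp.single (f.app _ x) 1)) (fun _ hx =>
    NChain.mk_single_eq_zero (app_mem_degenerate f hx))

/-- The automorphism `t(x, y) = (y, x)` of `C_*^N(X × X)`. -/
def swap (R : Type) [CommRing R] (X : SSet.{u}) (n : ℕ) :
    NChain R (X ⊗ X) n →ₗ[R] NChain R (X ⊗ X) n := NChain.map R (β_ X X).hom n

/-- The diagonal map `Δ(x) = (x, x)`. -/
def diag (R : Type) [CommRing R] (X : SSet.{u}) (n : ℕ) :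
    NChain R X n →ₗ[R] NChain R (X ⊗ X) n :=
  NChain.map R (CartesianMonoidalCategory.lift (𝟙 X) (𝟙 X)) n

/-- The iterate `(t SHI)^n`, on chains of degree `m`. -/
def tSHIPow (R : Type) [CommRing R] (X : SSet.{u}) (m n : ℕ) :
    NChain R (X ⊗ X) m →ₗ[R] NChain R (X ⊗ X) (m + n) :=
  match n with
  | 0 => LinearMap.id
  | n + 1 => swap R X (m + n + 1) ∘ₗ SHI R X X (m + n) ∘ₗ tSHIPow R X m n

/-- The functional `z ↦ μ⟨c ⊗ c', z⟩` on the degree `m` part of `C_*^N(X) ⊗ C_*^N(X)`, where `μ` is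
the multiplication of `R`. Only the component of `z` in the bidegree of `c ⊗ c'` contributes. -/
def evTensor {X : SSet.{u}} {j j' : ℕ} (c : NCochain R X j) (c' : NCochain R X j') (m : ℕ) :
    TensorChain R X X m →ₗ[R] R :=
  if h : j + j' = m then
    LinearMap.mul' R R ∘ₗ TensorProduct.map c c' ∘ₗ
      LinearMap.proj (R := R)
        (φ := fun d : {d : ℕ × ℕ // d.1 + d.2 = m} => NChain R X d.1.1 ⊗[R] NChain R X d.1.2)
        ⟨(j, j'), h⟩
  else 0

end Operators

/-- The cochain `Sq^i(c)`: its value at `x` is `μ⟨c ⊗ c, AW (t SHI)^{j-i}(x, x)⟩` if `i ≤ j`, and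
`0` otherwise. -/
def Sq {X : SSet.{u}} {j : ℕ} (i : ℕ) (c : NCochain (ZMod 2) X j) :
    NCochain (ZMod 2) X (i + j) :=
  if i ≤ j then
    evTensor c c (i + j + (j - i)) ∘ₗ AW (ZMod 2) X X (i + j + (j - i)) ∘ₗ
      tSHIPow (ZMod 2) X (i + j) (j - i) ∘ₗ diag (ZMod 2) X (i + j)
  else 0

/-! ### The explicit formula -/

/-- The lower bound `S(k) = i_{k+1} - i_{k+2} + ⋯ + (-1)^{k+n-1} i_n
+ (-1)^{k+n} ⌊(m+1)/2⌋ + ⌊k/2⌋`; it depends only on `i_{k+1}, …, i_n`. -/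
def lowerBound (n m : ℕ) (ι : ℕ → ℤ) (k : ℕ) : ℤ :=
  ∑ l ∈ Finset.Ioc k n, (-1) ^ (k + l + 1) * ι l + (-1) ^ (k + n) * (((m + 1) / 2 : ℕ) : ℤ)
    + ((k / 2 : ℕ) : ℤ)

/-- The inner part of the nested sum, over `i_k, …, i_1`, once `i_{k+1}, …, i_n` are chosen; the
index `i_l` (`1 ≤ l ≤ k`) runs from `S(l)` to `i_{l+1} - 1`, and finally `i_0 = S(0)`. -/
def innerSum (n m : ℕ) (F : (ℕ → ℤ) → ZMod 2) (k : ℕ) (ι : ℕ → ℤ) : ZMod 2 :=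
  match k with
  | 0 => F (Function.update ι 0 (lowerBound n m ι 0))
  | k + 1 => ∑ v ∈ Finset.Icc (lowerBound n m ι (k + 1)) (ι (k + 2) - 1),
      innerSum n m F k (Function.update ι (k + 1) v)

/-- The nested sum `∑_{i_n=S(n)}^{m} ∑_{i_{n-1}=S(n-1)}^{i_n-1} ⋯ ∑_{i_1=S(1)}^{i_2-1} F(i_0,…,i_n)`
with `i_0 = S(0)`. The auxiliary value `i_{n+1} = m + 1` encodes the upper limit of `i_n`. -/
def nestedSum (n m : ℕ) (F : (ℕ → ℤ) → ZMod 2) : ZMod 2 :=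
  innerSum n m F n (fun _ => (m : ℤ) + 1)

/-- The list `[a, a + 1, …, b]` of indices of the product `∂_a ⋯ ∂_b`, empty if `b < a`
(for `0 ≤ a`). -/
def block (a b : ℤ) : List ℕ := List.Ico a.toNat (b + 1).toNat

/-- For `n` even: `∂_{i_0+1} ⋯ ∂_{i_1-1} ∂_{i_2+1} ⋯ ∂_{i_{n-1}-1} ∂_{i_n+1} ⋯ ∂_m`. -/
def evenLeft (n m : ℕ) (ι : ℕ → ℤ) : List ℕ :=
  (List.range (n / 2)).flatMap (fun k => block (ι (2 * k) + 1) (ι (2 * k + 1) - 1)) ++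
    block (ι n + 1) m

/-- For `n` even: `∂_0 ⋯ ∂_{i_0-1} ∂_{i_1+1} ⋯ ∂_{i_{n-2}-1} ∂_{i_{n-1}+1} ⋯ ∂_{i_n-1}`. -/
def evenRight (n : ℕ) (ι : ℕ → ℤ) : List ℕ :=
  block 0 (ι 0 - 1) ++
    (List.range (n / 2)).flatMap (fun k => block (ι (2 * k + 1) + 1) (ι (2 * k + 2) - 1))

/-- For `n` odd: `∂_{i_0+1} ⋯ ∂_{i_1-1} ∂_{i_2+1} ⋯ ∂_{i_{n-2}-1} ∂_{i_{n-1}+1} ⋯ ∂_{i_n-1}`. -/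
def oddLeft (n : ℕ) (ι : ℕ → ℤ) : List ℕ :=
  (List.range ((n + 1) / 2)).flatMap (fun k => block (ι (2 * k) + 1) (ι (2 * k + 1) - 1))

/-- For `n` odd: `∂_0 ⋯ ∂_{i_0-1} ∂_{i_1+1} ⋯ ∂_{i_{n-1}-1} ∂_{i_n+1} ⋯ ∂_m`. -/
def oddRight (n m : ℕ) (ι : ℕ → ℤ) : List ℕ :=
  block 0 (ι 0 - 1) ++
    (List.range ((n - 1) / 2)).flatMap (fun k => block (ι (2 * k + 1) + 1) (ι (2 * k + 2) - 1)) ++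
      block (ι n + 1) m

end SteenrodSquare

end

/-! For simplices a, b of degree m, the value of c ⊗ c on AW (t SHI)^n (a × b) has a closed form
that does not mention shuffles (`shihEval_mk`, for m + n = 2j). Choose n + 1 cut points I in {0, …,
m}. They divide {0, …, m} into n + 2 intervals, neighbouring intervals sharing their cut point.
Distribute the intervals alternately, the last one to B and the one before it to A. The value is the
sum over all I of c(a restricted to A) · c(b restricted to B).

This is proved by induction on n. A summand of SHI pulls both factors back along monotone vertex
maps that are the identity up to some w and then follow a lattice path determined by a shuffle
(`swap_shiTerm`). A normalized cochain vanishes on degenerate simplices, so a term survives only if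
both maps are injective on the vertex sets selected by the cuts (`evOn_of_isPull`). This forces the
path to make all its moves in one direction and then all its moves in the other, with the last cut
at the turning point and the remaining cuts below w (`shuffle_unique`). Pushing the vertex sets
forward then replaces this last cut by two cuts w and w + 1 + p and exchanges A with B, which
matches the transposition t (`jumpPath_vertsA`, `jumpPath_vertsB`). As w and p vary, every set with
one more cut appears exactly once.

It remains to compare the sum over all cut sets i_0 < ⋯ < i_n with the nested sum. The words of face
operators delete exactly the complements of A and B. The condition that the first factor have degree
j is linear in the cuts and says i_0 = S(0). Because S(k) + S(k+1) = i_{k+1} + k, it implies k ≤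
S(k) ≤ i_k for every k, so the lower limits of the nested sum discard only zero terms
(`innerSum_eq`); conversely these limits ensure that S(0) is a legitimate smallest cut. Finally n =
j - i and m = i + j have the same parity, which decides the factor containing the last block. -/

noncomputable section

namespace SteenrodSquare

/-! ### Cochains evaluated on faces given by their vertex sets -/

section VertexSets

variable {X : SSet.{u}} {R : Type} [CommRing R] {j : ℕ}

/-- The value of a cochain at the face of `a` spanned by the vertices in `P`, with value `0` if
`P` is not the set of vertices of a face of the right dimension. -/
def evOn (c : NCochain R X j) {m : ℕ} (a : X _⦋m⦌) (P : Finset ℕ) : R :=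
  open Classical in
  if h : ∃ g : ⦋j⦌ ⟶ ⦋m⦌, StrictMono g.toOrderHom ∧
      Set.range (fun v => (g.toOrderHom v : ℕ)) = P then
    c (NChain.mk R X j (Finsupp.single (X.map h.choose.op a) 1)) else 0

/-- A strictly increasing map is determined by its range, so the choice made in `evOn` is
immaterial. -/
lemma evOn_eq (c : NCochain R X j) {m : ℕ} (a : X _⦋m⦌) {P : Finset ℕ} (g : ⦋j⦌ ⟶ ⦋m⦌)
    (hg : StrictMono g.toOrderHom) (hP : Set.range (fun v => (g.toOrderHom v : ℕ)) = P) :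
    evOn c a P = c (NChain.mk R X j (Finsupp.single (X.map g.op a) 1)) := by
  have h : ∃ g : ⦋j⦌ ⟶ ⦋m⦌, StrictMono g.toOrderHom ∧
      Set.range (fun v => (g.toOrderHom v : ℕ)) = P := ⟨g, hg, hP⟩
  rw [evOn, dif_pos h]
  have e : h.choose = g := by
    obtain ⟨h1, h2⟩ := h.choose_spec
    generalize h.choose = g' at h1 h2
    have h1' : StrictMono (fun v => (g'.toOrderHom v : ℕ)) := fun x y hxy => h1 hxy
    have hg' : StrictMono (fun v => (g.toOrderHom v : ℕ)) := fun x y hxy => hg hxy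
    have := (h1'.range_inj hg').1 (h2.trans hP.symm)
    ext v
    exact congrFun this v
  rw [e]

lemma card_of_range_eq {m : ℕ} {P : Finset ℕ} (g : ⦋j⦌ ⟶ ⦋m⦌) (hg : StrictMono g.toOrderHom)
    (hP : Set.range (fun v => (g.toOrderHom v : ℕ)) = P) : P.card = j + 1 := by
  have hg' : StrictMono (fun v => (g.toOrderHom v : ℕ)) := fun x y hxy => hg hxy
  have : P = Finset.univ.image (fun v => (g.toOrderHom v : ℕ)) := by
    apply Finset.coe_injective
    rw [← hP]; simp
  rw [this, Finset.card_image_of_injective _ hg'.injective]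
  simp

lemma evOn_eq_zero_of_card (c : NCochain R X j) {m : ℕ} (a : X _⦋m⦌) {P : Finset ℕ}
    (hP : P.card ≠ j + 1) : evOn c a P = 0 := by
  rw [evOn, dif_neg]
  rintro ⟨g, hg, h⟩
  exact hP (card_of_range_eq g hg h)

lemma exists_hom_of_card {m : ℕ} {P : Finset ℕ} (hP : P ⊆ Finset.range (m + 1))
    (hc : P.card = j + 1) : ∃ g : ⦋j⦌ ⟶ ⦋m⦌, StrictMono g.toOrderHom ∧
      Set.range (fun v => (g.toOrderHom v : ℕ)) = P := by
  have hb : ∀ v, P.orderEmbOfFin hc v < m + 1 := fun v =>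
    Finset.mem_range.1 (hP (P.orderEmbOfFin_mem hc v))
  have hs : StrictMono (fun v => (⟨P.orderEmbOfFin hc v, hb v⟩ : Fin (m + 1))) :=
    fun x y hxy => (P.orderEmbOfFin hc).strictMono hxy
  exact ⟨SimplexCategory.Hom.mk ⟨_, hs.monotone⟩, hs, P.range_orderEmbOfFin hc⟩

lemma mem_degenerate_of_not_injective {n m : ℕ} (g : ⦋n⦌ ⟶ ⦋m⦌)
    (hg : ¬ Function.Injective g.toOrderHom) (a : X _⦋m⦌) : X.map g.op a ∈ X.degenerate n := by
  obtain _ | n := n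
  · refine (hg fun x y _ => ?_).elim
    exact Subsingleton.elim (α := Fin 1) x y
  obtain ⟨i, θ, rfl⟩ := SimplexCategory.eq_σ_comp_of_not_injective g hg
  rw [op_comp, X.map_comp, ConcreteCategory.comp_apply]
  exact SSet.σ_mem_degenerate _ _ _

/-- Restriction to vertex sets is compatible with simplicial operators. -/
lemma evOn_of_isPull (c : NCochain R X j) {m M : ℕ} {a : X _⦋m⦌} {a' : X _⦋M⦌} {f : ℕ → ℕ}
    (h : IsPull ⟨m, a⟩ f ⟨M, a'⟩) {P : Finset ℕ} (hP : P ⊆ Finset.range (M + 1)) :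
    (Set.InjOn f P → evOn c a' P = evOn c a (P.image f)) ∧
      (¬ Set.InjOn f P → evOn c a' P = 0) := by
  obtain ⟨θ, h1, h2⟩ := h
  dsimp only at θ h1 h2
  by_cases hc : P.card = j + 1
  · obtain ⟨g, hg, hr⟩ := exists_hom_of_card hP hc
    rw [evOn_eq c a' g hg hr, h1, ← ConcreteCategory.comp_apply, ← X.map_comp, ← op_comp]
    have hv : ∀ v, ((g ≫ θ).toOrderHom v : ℕ) = f (g.toOrderHom v) := fun v => h2 _
    have hmem : ∀ v, (g.toOrderHom v : ℕ) ∈ P := fun v => by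
      have : (g.toOrderHom v : ℕ) ∈ (P : Set ℕ) := hr ▸ ⟨v, rfl⟩
      exact this
    refine ⟨fun hf => ?_, fun hf => ?_⟩
    · rw [evOn_eq c a (g ≫ θ)]
      · refine (g ≫ θ).toOrderHom.monotone.strictMono_of_injective fun x y hxy => ?_
        have := congrArg Fin.val hxy
        rw [hv, hv] at this
        exact hg.injective (Fin.ext (hf (hmem x) (hmem y) this))
      · rw [Finset.coe_image, ← hr, ← Set.range_comp]
        exact congrArg Set.range (funext hv)
    · rw [NChain.mk_single_eq_zero, map_zero]
      refine mem_degenerate_of_not_injective _ (fun hi => hf ?_) a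
      rintro x hx y hy hxy
      rw [← hr] at hx hy
      obtain ⟨v, rfl⟩ := hx
      obtain ⟨v', rfl⟩ := hy
      rw [hi (Fin.ext (by rw [hv, hv]; exact hxy) :
        (g ≫ θ).toOrderHom v = (g ≫ θ).toOrderHom v')]
  · rw [evOn_eq_zero_of_card c a' hc]
    refine ⟨fun hf => ?_, fun _ => rfl⟩
    rw [evOn_eq_zero_of_card]
    rwa [Finset.card_image_of_injOn hf]

lemma ev_eq_evOn (c : NCochain R X j) (s : Simplex X) :
    ev c s = evOn c s.2 (Finset.range (s.1 + 1)) := by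
  obtain ⟨n, a⟩ := s
  unfold ev cls
  split_ifs with h
  · dsimp only at h
    subst h
    rw [evOn_eq c a (𝟙 _) (fun x y h => h)]
    · simp
    · ext x
      simp only [Set.mem_range, Finset.coe_range, Set.mem_Iio]
      exact ⟨fun ⟨v, hv⟩ => hv ▸ v.2, fun hx => ⟨⟨x, hx⟩, rfl⟩⟩
  · rw [map_zero, evOn_eq_zero_of_card]
    simpa using h

lemma ev_of_isPull (c : NCochain R X j) {m : ℕ} {a : X _⦋m⦌} {s : Simplex X} {f : ℕ → ℕ}
    (h : IsPull ⟨m, a⟩ f s) (hf : Set.InjOn f (Finset.range (s.1 + 1))) :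
    ev c s = evOn c a ((Finset.range (s.1 + 1)).image f) := by
  rw [ev_eq_evOn, (evOn_of_isPull c h subset_rfl).1 hf]

/-- Deleting the vertices in an increasing list. -/
lemma isPull_faces_sorted {m : ℕ} (a : X _⦋m⦌) (w : List ℕ) (hw : w.Pairwise (· < ·))
    (hb : ∀ b ∈ w, b ≤ m) (hl : w.length ≤ m) :
    (faces w ⟨m, a⟩).1 + w.length = m ∧ ∃ f, IsPull ⟨m, a⟩ f (faces w ⟨m, a⟩) ∧
      Set.InjOn f (Finset.range ((faces w ⟨m, a⟩).1 + 1)) ∧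
      (Finset.range ((faces w ⟨m, a⟩).1 + 1)).image f = Finset.range (m + 1) \ w.toFinset ∧
      (∀ v, (∀ b ∈ w, v < b) → f v = v) := by
  induction w with
  | nil => exact ⟨rfl, id, isPull_refl _, Function.injective_id.injOn, by simp [faces], by simp⟩
  | cons b w ih =>
    rw [List.pairwise_cons] at hw
    simp only [List.length_cons] at hl
    obtain ⟨i1, f, i2, i3, i4, i5⟩ := ih hw.2 (fun x hx => hb x (by simp [hx])) (by omega)
    -- The letters of `w` lie in {b + 1, …, m}, so after they have acted the degree is still at
    -- least b and the operator `face b` is meaningful.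
    have hlen : b + w.length ≤ m := by
      have hsub : w.toFinset ⊆ Finset.Ioc b m := fun x hx => by
        rw [List.mem_toFinset] at hx
        exact Finset.mem_Ioc.2 ⟨hw.1 x hx, hb x (by simp [hx])⟩
      have := Finset.card_le_card hsub
      rw [List.toFinset_card_of_nodup (hw.2.imp fun h => ne_of_lt h), Nat.card_Ioc] at this
      have := hb b (by simp)
      omega
    obtain ⟨j1, j2⟩ := i2.face (k := b) (by omega) (by omega)
    have e : faces (b :: w) ⟨m, a⟩ = face b (faces w ⟨m, a⟩) := rfl
    rw [e]
    generalize faces w ⟨m, a⟩ = s at *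
    have hinj : Set.InjOn (fun v => f (if v < b then v else v + 1))
        (Finset.range ((face b s).1 + 1)) := by
      intro x hx y hy hxy
      simp only [Finset.coe_range, Set.mem_Iio] at hx hy
      have := i3 (x₁ := if x < b then x else x + 1) (x₂ := if y < b then y else y + 1)
        (by simp only [Finset.coe_range, Set.mem_Iio]; split_ifs <;> omega)
        (by simp only [Finset.coe_range, Set.mem_Iio]; split_ifs <;> omega) hxy
      split_ifs at this <;> omega
    refine ⟨by simp only [List.length_cons]; omega, _, j2, hinj, ?_, ?_⟩
    -- The later letters all exceed b, so b still carries its original label and `face b` deletes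
    -- exactly this vertex. The last clause of the statement exists to supply this.
    · have hfb : f b = b := i5 b hw.1
      have e1 : Finset.range (m + 1) \ (b :: w).toFinset =
          (Finset.range (m + 1) \ w.toFinset).erase b := by
        ext x; simp; tauto
      rw [e1, ← i4]
      ext x
      simp only [Finset.mem_image, Finset.mem_erase, Finset.mem_range]
      constructor
      · rintro ⟨v, hv, rfl⟩
        refine ⟨fun h => ?_, _, ?_, rfl⟩
        · have := i3 (x₁ := if v < b then v else v + 1) (x₂ := b)
            (by simp only [Finset.coe_range, Set.mem_Iio]; split_ifs <;> omega)
            (by simp only [Finset.coe_range, Set.mem_Iio]; omega) (h.trans hfb.symm)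
          split_ifs at this <;> omega
        · split_ifs <;> omega
      · rintro ⟨hx, v, hv, rfl⟩
        have : v ≠ b := by rintro rfl; exact hx hfb
        by_cases hvb : v < b
        · exact ⟨v, by omega, by rw [if_pos hvb]⟩
        · exact ⟨v - 1, by omega, by rw [if_neg (by omega)]; congr 1; omega⟩
    · intro v hv
      have hv0 := hv b (by simp)
      rw [if_pos hv0]
      exact i5 v fun x hx => hv x (by simp [hx])

lemma ev_faces_sorted (c : NCochain R X j) {m : ℕ} (a : X _⦋m⦌) (w : List ℕ)
    (hw : w.Pairwise (· < ·)) (hb : ∀ b ∈ w, b ≤ m) (hl : w.length ≤ m) :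
    ev c (faces w ⟨m, a⟩) = evOn c a (Finset.range (m + 1) \ w.toFinset) := by
  obtain ⟨-, f, h1, h2, h3, -⟩ := isPull_faces_sorted a w hw hb hl
  rw [ev_of_isPull c h1 h2, h3]

end VertexSets

/-! ### Cut sets, alternating vertex sets and shuffle paths -/

section Shuffles

/-- The number of elements of `I` above `v`. -/
def up (I : Finset ℕ) (v : ℕ) : ℕ := (I.filter (v < ·)).card

/-- The union of the intervals of `{0, …, m}` cut out by `I`, starting with the last but one and
taking every other one. -/
def vertsA (m : ℕ) (I : Finset ℕ) : Finset ℕ :=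
  (Finset.range (m + 1)).filter fun v => v ∈ I ∨ Odd (up I v)

/-- The union of the intervals of `{0, …, m}` cut out by `I`, starting with the last one and
taking every other one. -/
def vertsB (m : ℕ) (I : Finset ℕ) : Finset ℕ :=
  (Finset.range (m + 1)).filter fun v => v ∈ I ∨ Even (up I v)

lemma mem_vertsA {m v : ℕ} {I : Finset ℕ} :
    v ∈ vertsA m I ↔ v ≤ m ∧ (v ∈ I ∨ Odd (up I v)) := by
  simp [vertsA]

lemma mem_vertsB {m v : ℕ} {I : Finset ℕ} :
    v ∈ vertsB m I ↔ v ≤ m ∧ (v ∈ I ∨ Even (up I v)) := by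
  simp [vertsB]

lemma up_eq_of_forall {I : Finset ℕ} {v v' : ℕ} (h : v ≤ v') (h' : ∀ i ∈ I, v < i → v' < i) :
    up I v = up I v' := by
  unfold up
  congr 1
  refine Finset.filter_congr fun i hi => ⟨h' i hi, fun h'' => by omega⟩

lemma up_eq_zero_iff {I : Finset ℕ} {v : ℕ} : up I v = 0 ↔ ∀ i ∈ I, i ≤ v := by
  simp [up, Finset.filter_eq_empty_iff]

lemma up_insert {I : Finset ℕ} {i v : ℕ} (hi : i ∉ I) :
    up (insert i I) v = up I v + if v < i then 1 else 0 := by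
  unfold up
  rw [Finset.filter_insert]
  split_ifs
  · rw [Finset.card_insert_of_notMem (by simp [hi])]
  · rfl

lemma up_succ (I : Finset ℕ) (v : ℕ) : up I v = up I (v + 1) + if v + 1 ∈ I then 1 else 0 := by
  by_cases h : v + 1 ∈ I
  · obtain ⟨J, hJ, rfl⟩ : ∃ J, v + 1 ∉ J ∧ I = insert (v + 1) J :=
      ⟨I.erase (v + 1), by simp, by rw [Finset.insert_erase h]⟩
    rw [up_insert hJ, up_insert hJ]
    have := up_eq_of_forall (I := J) (v := v) (v' := v + 1) (by omega) (fun i hi h' => by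
      have : i ≠ v + 1 := by rintro rfl; exact hJ hi
      omega)
    simp [this]
  · rw [if_neg h]
    exact up_eq_of_forall (by omega) (fun i hi h' => by
      have : i ≠ v + 1 := by rintro rfl; exact h hi
      omega)

/-- The edge from v to v + 1 lies inside a single interval of the subdivision, and the parity of the
number of cuts above v tells which side owns it. Hence a path injective on the side owning an edge
must move along that edge. -/
lemma edge_vertsA {m v : ℕ} {I : Finset ℕ} (hv : v < m) (h : Odd (up I v)) :
    v ∈ vertsA m I ∧ v + 1 ∈ vertsA m I := by
  rw [mem_vertsA, mem_vertsA]
  have := up_succ I v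
  by_cases h' : v + 1 ∈ I
  · exact ⟨⟨by omega, Or.inr h⟩, by omega, Or.inl h'⟩
  · rw [if_neg h'] at this
    exact ⟨⟨by omega, Or.inr h⟩, by omega, Or.inr (by rwa [this] at h)⟩

lemma edge_vertsB {m v : ℕ} {I : Finset ℕ} (hv : v < m) (h : Even (up I v)) :
    v ∈ vertsB m I ∧ v + 1 ∈ vertsB m I := by
  rw [mem_vertsB, mem_vertsB]
  have := up_succ I v
  by_cases h' : v + 1 ∈ I
  · exact ⟨⟨by omega, Or.inr h⟩, by omega, Or.inl h'⟩
  · rw [if_neg h'] at this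
    exact ⟨⟨by omega, Or.inr h⟩, by omega, Or.inr (by rwa [this] at h)⟩

/-- The path which is the identity up to `w`, jumps to `r`, and then moves at the times in
`w + 1 + s`. -/
def jumpPath (w r : ℕ) (s : Finset ℕ) (v : ℕ) : ℕ :=
  if v ≤ w then v else r + (s.filter (· + (w + 1) < v)).card

lemma jumpPath_of_le {w r v : ℕ} {s : Finset ℕ} (h : v ≤ w) : jumpPath w r s v = v := if_pos h

lemma jumpPath_add (w r y : ℕ) (s : Finset ℕ) :
    jumpPath w r s (w + 1 + y) = r + (s.filter (· < y)).card := by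
  rw [jumpPath, if_neg (by omega)]
  congr 2
  ext x
  simp only [Finset.mem_filter, and_congr_right_iff]
  omega

lemma jumpPath_succ (w r y : ℕ) (s : Finset ℕ) :
    jumpPath w r s (w + 1 + y + 1) = jumpPath w r s (w + 1 + y) + if y ∈ s then 1 else 0 := by
  rw [add_assoc (w + 1), jumpPath_add, jumpPath_add, card_filter_lt_succ, add_assoc]

lemma exists_next {I : Finset ℕ} {v : ℕ} (h : up I v ≠ 0) :
    ∃ e ∈ I, v < e ∧ (∀ i ∈ I, v < i → e ≤ i) ∧ up I v = up I e + 1 := by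
  have hne : (I.filter (v < ·)).Nonempty := Finset.card_ne_zero.1 h
  have hm := Finset.min'_mem _ hne
  have hl : ∀ i ∈ I.filter (v < ·), (I.filter (v < ·)).min' hne ≤ i :=
    fun i hi => Finset.min'_le _ i hi
  generalize (I.filter (v < ·)).min' hne = e at hm hl
  simp only [Finset.mem_filter, and_imp] at hm hl
  obtain ⟨he, hve⟩ := hm
  refine ⟨e, he, hve, hl, ?_⟩
  obtain ⟨e, rfl⟩ : ∃ e', e = e' + 1 := ⟨e - 1, by omega⟩
  rw [up_eq_of_forall (v' := e) (by omega) (fun i hi hvi => hl i hi hvi), up_succ, if_pos he]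

/-- A shuffle path which does not degenerate on the two vertex sets determined by `I` moves first
in one direction and then in the other. -/
lemma shuffle_unique {w p q : ℕ} {α I : Finset ℕ} (hα : α ⊆ Finset.range (p + q + 1))
    (hc : α.card = p + 1) (hI : I ⊆ Finset.range (w + 1 + p + q + 1 + 1))
    (hF : Set.InjOn (jumpPath w (w + 1 + p) (Finset.range (p + q + 1) \ α))
      (vertsA (w + 1 + p + q + 1) I))
    (hG : Set.InjOn (jumpPath w w α) (vertsB (w + 1 + p + q + 1) I)) :
    α = Finset.Ico q (p + q + 1) ∧ ∃ J ⊆ Finset.range w, I = insert (w + 1 + q) J := by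
  have hI' : ∀ i ∈ I, i ≤ w + 1 + p + q + 1 := fun i hi => by
    have := Finset.mem_range.1 (hI hi); omega
  have hB : ∀ v, v < w + 1 + p + q + 1 → Even (up I v) →
      jumpPath w w α v ≠ jumpPath w w α (v + 1) := fun v hv h h' => by
    have := hG (edge_vertsB hv h).1 (edge_vertsB hv h).2 h'
    omega
  have hA : ∀ v, v < w + 1 + p + q + 1 → Odd (up I v) →
      jumpPath w (w + 1 + p) (Finset.range (p + q + 1) \ α) v ≠
        jumpPath w (w + 1 + p) (Finset.range (p + q + 1) \ α) (v + 1) := fun v hv h h' => by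
    have := hF (edge_vertsA hv h).1 (edge_vertsA hv h).2 h'
    omega
  have hBα : ∀ y < p + q + 1, Even (up I (w + 1 + y)) → y ∈ α := fun y hy h => by
    by_contra hn
    refine hB _ (by omega) h ?_
    rw [jumpPath_succ, if_neg hn, add_zero]
  have hAα : ∀ y < p + q + 1, Odd (up I (w + 1 + y)) → y ∉ α := fun y hy h hn => by
    refine hA _ (by omega) h ?_
    rw [jumpPath_succ, if_neg (by simp [hn]), add_zero]
  -- The path used on B repeats the value w at w + 1, so B cannot own the edge from w to w + 1.
  have h1 : Odd (up I w) := by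
    rw [← Nat.not_even_iff_odd]
    intro h
    refine hB w (by omega) h ?_
    have := jumpPath_add w w 0 α
    simp only [add_zero, not_lt_zero, Finset.filter_false, Finset.card_empty] at this
    rw [this, jumpPath_of_le le_rfl]
  obtain ⟨e, he, hwe, hel, hue⟩ := exists_next (I := I) (v := w) (by rintro h; simp [h] at h1)
  have hue' : Even (up I e) := by
    rw [hue] at h1
    exact Nat.not_odd_iff_even.1 fun h => Nat.not_odd_iff_even.2 h.add_one h1
  -- Suppose there were a next cut f after e. The interval [e, f] belongs to B, so every move there
  -- is made by the path with times α, and the complementary path is constant on it. But e and f,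
  -- being cuts, both lie in A, where that path is injective.
  have h2 : up I e = 0 := by
    by_contra hne
    obtain ⟨f, hf, hef, hfl, huf⟩ := exists_next hne
    have hconst : ∀ v, e ≤ v → v ≤ f →
        jumpPath w (w + 1 + p) (Finset.range (p + q + 1) \ α) v =
          jumpPath w (w + 1 + p) (Finset.range (p + q + 1) \ α) e := by
      intro v hv
      induction v, hv using Nat.le_induction with
      | base => simp
      | succ v hv ih =>
        intro hvf
        obtain ⟨y, rfl⟩ : ∃ y, v = w + 1 + y := ⟨v - (w + 1), by omega⟩
        have hev : Even (up I (w + 1 + y)) := by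
          rwa [← up_eq_of_forall hv fun i hi hei => by have := hfl i hi hei; omega]
        have := hI' f hf
        rw [jumpPath_succ, if_neg (by simp [hBα y (by omega) hev]), add_zero, ih (by omega)]
    have := hF (mem_vertsA.2 ⟨hI' f hf, Or.inl hf⟩) (mem_vertsA.2 ⟨hI' e he, Or.inl he⟩)
      (hconst f hef.le le_rfl)
    omega
  have hmax := up_eq_zero_iff.1 h2
  -- Edges between w and e belong to A and exclude their times from α; edges after e belong to B and
  -- force their times into α. The cardinality of α then fixes e.
  have hα' : α = Finset.Ico (e - (w + 1)) (p + q + 1) := by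
    ext y
    rw [Finset.mem_Ico]
    constructor
    · intro hy
      have hy' := Finset.mem_range.1 (hα hy)
      refine ⟨?_, hy'⟩
      by_contra hlt
      refine hAα y hy' ?_ hy
      rwa [← up_eq_of_forall (v := w) (by omega)]
      intro i hi hwi
      have := hel i hi hwi
      omega
    · rintro ⟨hy, hy'⟩
      refine hBα y hy' ?_
      rw [up_eq_zero_iff.2 fun i hi => by have := hmax i hi; omega]
      exact Even.zero
  have heM := hI' e he
  obtain ⟨q', rfl⟩ : ∃ q', e = w + 1 + q' := ⟨e - (w + 1), by omega⟩
  have hq : q' = q := by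
    have := congrArg Finset.card hα'
    rw [hc, Nat.card_Ico] at this
    omega
  subst hq
  rw [Nat.add_sub_cancel_left] at hα'
  refine ⟨hα', I.erase (w + 1 + q'), fun i hi => ?_, (Finset.insert_erase he).symm⟩
  rw [Finset.mem_erase] at hi
  rw [Finset.mem_range]
  by_contra hlt
  -- No cut lies strictly between w and e or above e, so only i = w has to be excluded. In that case
  -- w and e would both lie in B although the path on B takes the value w at both.
  have hiw : i = w := by
    by_contra hne
    have := hel i hi.2 (by omega)
    have := hmax i hi.2
    exact hi.1 (by omega)
  subst hiw
  have := hG (mem_vertsB.2 ⟨by omega, Or.inl hi.2⟩) (mem_vertsB.2 ⟨by omega, Or.inl he⟩) (by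
    rw [jumpPath_of_le le_rfl, jumpPath_add, hα', Finset.card_eq_zero.2, add_zero]
    rw [Finset.filter_eq_empty_iff]
    intro x hx
    have := (Finset.mem_Ico.1 hx).1
    omega)
  omega

lemma up_of_subset_range {w v : ℕ} {J : Finset ℕ} (hJ : J ⊆ Finset.range w) (hv : w ≤ v + 1) :
    up J v = 0 :=
  up_eq_zero_iff.2 fun i hi => by have := Finset.mem_range.1 (hJ hi); omega

lemma jumpPath_first {w r q v : ℕ} (h : w < v) (h' : v ≤ w + 1 + q) :
    jumpPath w r (Finset.range q) v = r + (v - (w + 1)) := by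
  obtain ⟨y, rfl⟩ : ∃ y, v = w + 1 + y := ⟨v - (w + 1), by omega⟩
  rw [jumpPath_add, Nat.add_sub_cancel_left]
  congr 1
  rw [show (Finset.range q).filter (· < y) = Finset.range y by ext x; simp; omega,
    Finset.card_range]

lemma jumpPath_last {w r q N v : ℕ} (h : w + 1 + q ≤ v) (h' : v ≤ w + 1 + N) :
    jumpPath w r (Finset.Ico q N) v = r + (v - (w + 1 + q)) := by
  obtain ⟨y, rfl⟩ : ∃ y, v = w + 1 + y := ⟨v - (w + 1), by omega⟩
  rw [jumpPath_add]
  congr 1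
  rw [show (Finset.Ico q N).filter (· < y) = Finset.Ico q y by ext x; simp; omega,
    Nat.card_Ico]
  omega

/-- Below w, the single cut above w shifts the parity once, so A looks like the B-part of J. With
the two cuts of `mem_vertsB_insert` the parity is shifted twice and the B-part of J is again what is
seen. This is why A before the push-forward matches B after it. -/
lemma mem_vertsA_jump {w p q v : ℕ} {J : Finset ℕ} (hJ : J ⊆ Finset.range w) :
    v ∈ vertsA (w + 1 + p + q + 1) (insert (w + 1 + q) J) ↔
      (v < w ∧ (v ∈ J ∨ Even (up J v))) ∨ (w ≤ v ∧ v ≤ w + 1 + q) := by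
  have hJ' : ∀ i ∈ J, i < w := fun i hi => Finset.mem_range.1 (hJ hi)
  have hn : w + 1 + q ∉ J := fun h => by have := hJ' _ h; omega
  rw [mem_vertsA, Finset.mem_insert, up_insert hn]
  by_cases h1 : v < w
  · simp only [h1, true_and, show ¬ w ≤ v by omega, false_and, or_false,
      show v ≠ w + 1 + q by omega, false_or, show v < w + 1 + q by omega, if_true,
      show v ≤ w + 1 + p + q + 1 by omega]
    rw [Nat.odd_add_one, Nat.not_odd_iff_even]
  · have h2 : v ∉ J := fun h => h1 (hJ' v h)
    rw [up_of_subset_range hJ (by omega)]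
    simp only [h1, false_and, false_or, h2, or_false]
    by_cases h3 : v < w + 1 + q
    · simp [h3]; omega
    · simp [h3]; omega

lemma mem_vertsB_jump {w p q v : ℕ} {J : Finset ℕ} (hJ : J ⊆ Finset.range w) :
    v ∈ vertsB (w + 1 + p + q + 1) (insert (w + 1 + q) J) ↔
      (v < w ∧ (v ∈ J ∨ Odd (up J v))) ∨ (w + 1 + q ≤ v ∧ v ≤ w + 1 + p + q + 1) := by
  have hJ' : ∀ i ∈ J, i < w := fun i hi => Finset.mem_range.1 (hJ hi)
  have hn : w + 1 + q ∉ J := fun h => by have := hJ' _ h; omega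
  rw [mem_vertsB, Finset.mem_insert, up_insert hn]
  by_cases h1 : v < w
  · simp only [h1, true_and, show ¬ w + 1 + q ≤ v by omega, false_and, or_false,
      show v ≠ w + 1 + q by omega, false_or, show v < w + 1 + q by omega, if_true,
      show v ≤ w + 1 + p + q + 1 by omega]
    rw [Nat.even_add_one, Nat.not_even_iff_odd]
  · have h2 : v ∉ J := fun h => h1 (hJ' v h)
    rw [up_of_subset_range hJ (by omega)]
    simp only [h1, false_and, false_or, h2, or_false]
    by_cases h3 : v < w + 1 + q
    · simp [h3]; omega
    · simp [h3]; omega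

lemma mem_vertsB_insert {w p q v : ℕ} {J : Finset ℕ} (hJ : J ⊆ Finset.range w) :
    v ∈ vertsB (w + 1 + p + q) (insert (w + 1 + p) (insert w J)) ↔
      (v < w ∧ (v ∈ J ∨ Even (up J v))) ∨ v = w ∨
        (w + 1 + p ≤ v ∧ v ≤ w + 1 + p + q) := by
  have hJ' : ∀ i ∈ J, i < w := fun i hi => Finset.mem_range.1 (hJ hi)
  have hn : w ∉ J := fun h => by have := hJ' _ h; omega
  have hn' : w + 1 + p ∉ insert w J := fun h => by
    rcases Finset.mem_insert.1 h with h | h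
    · omega
    · have := hJ' _ h; omega
  rw [mem_vertsB, Finset.mem_insert, Finset.mem_insert, up_insert hn', up_insert hn]
  by_cases h1 : v < w
  · simp only [h1, true_and, if_true, show v < w + 1 + p by omega, show v ≠ w + 1 + p by omega,
      show v ≠ w by omega, false_or, show v ≤ w + 1 + p + q by omega,
      show ¬ w + 1 + p ≤ v by omega, false_and, or_false]
    simp [Nat.even_add_one]
  · have h2 : v ∉ J := fun h => h1 (hJ' v h)
    rw [up_of_subset_range hJ (by omega)]
    simp only [h1, false_and, false_or, h2, or_false]
    by_cases h3 : v < w + 1 + p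
    · simp [h3]; omega
    · simp [h3]; omega

lemma mem_vertsA_insert {w p q v : ℕ} {J : Finset ℕ} (hJ : J ⊆ Finset.range w) :
    v ∈ vertsA (w + 1 + p + q) (insert (w + 1 + p) (insert w J)) ↔
      (v < w ∧ (v ∈ J ∨ Odd (up J v))) ∨ (w ≤ v ∧ v ≤ w + 1 + p) := by
  have hJ' : ∀ i ∈ J, i < w := fun i hi => Finset.mem_range.1 (hJ hi)
  have hn : w ∉ J := fun h => by have := hJ' _ h; omega
  have hn' : w + 1 + p ∉ insert w J := fun h => by
    rcases Finset.mem_insert.1 h with h | h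
    · omega
    · have := hJ' _ h; omega
  rw [mem_vertsA, Finset.mem_insert, Finset.mem_insert, up_insert hn', up_insert hn]
  by_cases h1 : v < w
  · simp only [h1, true_and, if_true, show v < w + 1 + p by omega, show v ≠ w + 1 + p by omega,
      show v ≠ w by omega, false_or, show v ≤ w + 1 + p + q by omega,
      show ¬ w ≤ v by omega, false_and, or_false]
    simp [Nat.odd_add_one]
  · have h2 : v ∉ J := fun h => h1 (hJ' v h)
    rw [up_of_subset_range hJ (by omega)]
    simp only [h1, false_and, false_or, h2, or_false]
    by_cases h3 : v < w + 1 + p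
    · simp [h3]; omega
    · simp [h3]; omega

lemma range_sdiff_Ico (p q : ℕ) :
    Finset.range (p + q + 1) \ Finset.Ico q (p + q + 1) = Finset.range q := by
  ext x; simp; omega

/-- The path fixes everything up to w, skips from w to w + 1 + p and then moves at each of its first
q times. It thus carries the interval [w, w + 1 + q] of A to w together with [w + 1 + p, m], which
is how the two new cuts arise. -/
lemma jumpPath_vertsA {w p q : ℕ} {J : Finset ℕ} (hJ : J ⊆ Finset.range w) :
    Set.InjOn (jumpPath w (w + 1 + p) (Finset.range q))
        (vertsA (w + 1 + p + q + 1) (insert (w + 1 + q) J)) ∧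
      (vertsA (w + 1 + p + q + 1) (insert (w + 1 + q) J)).image
        (jumpPath w (w + 1 + p) (Finset.range q)) =
      vertsB (w + 1 + p + q) (insert (w + 1 + p) (insert w J)) := by
  constructor
  · intro x hx y hy hxy
    rw [Finset.mem_coe, mem_vertsA_jump hJ] at hx hy
    rcases le_or_gt x w with h1 | h1 <;> rcases le_or_gt y w with h2 | h2
    · rwa [jumpPath_of_le h1, jumpPath_of_le h2] at hxy
    · rw [jumpPath_of_le h1, jumpPath_first h2 (by omega)] at hxy; omega
    · rw [jumpPath_of_le h2, jumpPath_first h1 (by omega)] at hxy; omega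
    · rw [jumpPath_first h2 (by omega), jumpPath_first h1 (by omega)] at hxy; omega
  · ext x
    rw [Finset.mem_image, mem_vertsB_insert hJ]
    constructor
    · rintro ⟨v, hv, rfl⟩
      rw [mem_vertsA_jump hJ] at hv
      rcases le_or_gt v w with h1 | h1
      · rw [jumpPath_of_le h1]
        rcases hv with hv | hv
        · exact Or.inl hv
        · omega
      · rw [jumpPath_first h1 (by omega)]; omega
    · intro hx
      rcases le_or_gt x w with h1 | h1
      · refine ⟨x, (mem_vertsA_jump hJ).2 ?_, jumpPath_of_le h1⟩
        rcases hx with hx | hx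
        · exact Or.inl hx
        · omega
      · refine ⟨x - p, (mem_vertsA_jump hJ).2 (by omega), ?_⟩
        rw [jumpPath_first (by omega) (by omega)]
        omega

/-- The path waits at w until the turning point w + 1 + q and then moves at every time, so the last
interval of B is carried onto [w, w + 1 + p]. This becomes the last but one interval of the new
subdivision, owned by A. -/
lemma jumpPath_vertsB {w p q : ℕ} {J : Finset ℕ} (hJ : J ⊆ Finset.range w) :
    Set.InjOn (jumpPath w w (Finset.Ico q (p + q + 1)))
        (vertsB (w + 1 + p + q + 1) (insert (w + 1 + q) J)) ∧
      (vertsB (w + 1 + p + q + 1) (insert (w + 1 + q) J)).image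
        (jumpPath w w (Finset.Ico q (p + q + 1))) =
      vertsA (w + 1 + p + q) (insert (w + 1 + p) (insert w J)) := by
  constructor
  · intro x hx y hy hxy
    rw [Finset.mem_coe, mem_vertsB_jump hJ] at hx hy
    rcases lt_or_ge x w with h1 | h1 <;> rcases lt_or_ge y w with h2 | h2
    · rwa [jumpPath_of_le h1.le, jumpPath_of_le h2.le] at hxy
    · rw [jumpPath_of_le h1.le, jumpPath_last (by omega) (by omega)] at hxy; omega
    · rw [jumpPath_of_le h2.le, jumpPath_last (by omega) (by omega)] at hxy; omega
    · rw [jumpPath_last (by omega) (by omega), jumpPath_last (by omega) (by omega)] at hxy; omega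
  · ext x
    rw [Finset.mem_image, mem_vertsA_insert hJ]
    constructor
    · rintro ⟨v, hv, rfl⟩
      rw [mem_vertsB_jump hJ] at hv
      rcases lt_or_ge v w with h1 | h1
      · rw [jumpPath_of_le h1.le]
        rcases hv with hv | hv
        · exact Or.inl hv
        · omega
      · rw [jumpPath_last (by omega) (by omega)]; omega
    · intro hx
      rcases lt_or_ge x w with h1 | h1
      · refine ⟨x, (mem_vertsB_jump hJ).2 ?_, jumpPath_of_le h1.le⟩
        rcases hx with hx | hx
        · exact Or.inl hx
        · omega
      · refine ⟨x + 1 + q, (mem_vertsB_jump hJ).2 (by omega), ?_⟩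
        rw [jumpPath_last (by omega) (by omega)]
        omega

end Shuffles

/-! ### The iterated Shih operator evaluated on c ⊗ c -/

section ShihOperator

variable {X Y : SSet.{u}}

/-- The simplex `x × y` of the product. -/
def pairing {n : ℕ} (x : X _⦋n⦌) (y : Y _⦋n⦌) : (X ⊗ Y) _⦋n⦌ := (⟨x, y⟩ : X _⦋n⦌ × Y _⦋n⦌)

lemma crossCls_mk {R : Type} [CommRing R] {n : ℕ} (x : X _⦋n⦌) (y : Y _⦋n⦌) :
    crossCls (R := R) n ⟨n, x⟩ ⟨n, y⟩ = NChain.mk R (X ⊗ Y) n (Finsupp.single (pairing x y) 1) :=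
  dif_pos ⟨rfl, rfl⟩

/-- The degeneracy s_w repeats the vertex w, and the degeneracies indexed by β are the pauses of the
path; counting pauses in β is complementary to counting moves in α. -/
lemma isPull_shi_fst {w p q : ℕ} (a : X _⦋w + 1 + p + q⦌) {α : Finset ℕ}
    (hα : α ⊆ Finset.range (p + q + 1)) (hc : α.card = p + 1) :
    ∃ x : X _⦋w + 1 + p + q + 1⦌,
      degens (shiftDesc (Finset.range (p + q + 1) \ α) (w + 1)) (degen w
        (faces (List.Ico (w + 1 + p + 1) (w + 1 + p + q + 1)) ⟨w + 1 + p + q, a⟩)) = ⟨_, x⟩ ∧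
      IsPull ⟨_, a⟩ (jumpPath w w α) ⟨_, x⟩ := by
  have hβc : (Finset.range (p + q + 1) \ α).card = q := by
    rw [Finset.card_sdiff_of_subset hα, hc, Finset.card_range]; omega
  obtain ⟨f1, f2⟩ := (isPull_refl (⟨w + 1 + p + q, a⟩ : Simplex X)).faces_Ico
      (a := w + 1 + p + 1) (b := w + 1 + p + q + 1) (by omega) (by dsimp only; omega)
      (by dsimp only; omega)
  dsimp only at f1
  obtain ⟨f3, f4⟩ := f2.degen (k := w) (by omega)
  obtain ⟨f5, f6⟩ := f4.degens_sorted (shiftDesc (Finset.range (p + q + 1) \ α) (w + 1))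
    (pairwise_shiftDesc _ _) (by
    intro x hx
    obtain ⟨y, hy, rfl⟩ := mem_shiftDesc.1 hx
    have := Finset.mem_range.1 (Finset.sdiff_subset hy)
    rw [length_shiftDesc]
    omega)
  simp only [length_filter_shiftDesc, id] at f6
  rw [length_shiftDesc, hβc] at f5
  generalize degens _ _ = s at *
  obtain ⟨N, x⟩ := s
  obtain rfl : N = w + 1 + p + q + 1 := by dsimp only at f5; omega
  refine ⟨x, rfl, f6.congr fun v hv => ?_⟩
  dsimp only at hv
  rcases le_or_gt v w with h | h
  · rw [jumpPath_of_le h, Finset.card_eq_zero.2]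
    · split_ifs <;> omega
    · rw [Finset.filter_eq_empty_iff]
      intro x _; omega
  · obtain ⟨y, rfl⟩ : ∃ y, v = w + 1 + y := ⟨v - (w + 1), by omega⟩
    rw [jumpPath_add]
    have h1 := card_filter_sdiff hα (v := y) (by omega)
    have h2 : ((Finset.range (p + q + 1) \ α).filter (· + (w + 1) < w + 1 + y)).card =
        ((Finset.range (p + q + 1) \ α).filter (· < y)).card := by
      congr 1
      exact Finset.filter_congr fun x _ => by omega
    rw [h2]
    -- With at most p + 1 moves the path never leaves {0, …, w + 1 + p}, where deleting the last q
    -- vertices has not relabelled anything.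
    have h3 : (α.filter (· < y)).card ≤ p + 1 := hc ▸ Finset.card_filter_le _ _
    split_ifs <;> omega

lemma isPull_shi_snd {w p q : ℕ} (b : X _⦋w + 1 + p + q⦌) {α : Finset ℕ}
    (hα : α ⊆ Finset.range (p + q + 1)) (hc : α.card = p + 1) :
    ∃ y : X _⦋w + 1 + p + q + 1⦌,
      degens (shiftDesc α (w + 1))
        (faces (List.Ico (w + 1) (w + 1 + p)) ⟨w + 1 + p + q, b⟩) = ⟨_, y⟩ ∧
      IsPull ⟨_, b⟩ (jumpPath w (w + 1 + p) (Finset.range (p + q + 1) \ α)) ⟨_, y⟩ := by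
  obtain ⟨g1, g2⟩ := (isPull_refl (⟨w + 1 + p + q, b⟩ : Simplex X)).faces_Ico
      (a := w + 1) (b := w + 1 + p) (by omega) (by dsimp only; omega)
      (by dsimp only; omega)
  dsimp only at g1
  obtain ⟨g3, g4⟩ := g2.degens_sorted (shiftDesc α (w + 1)) (pairwise_shiftDesc _ _) (by
    intro x hx
    obtain ⟨y, hy, rfl⟩ := mem_shiftDesc.1 hx
    have := Finset.mem_range.1 (hα hy)
    rw [length_shiftDesc]
    omega)
  simp only [length_filter_shiftDesc, id] at g4
  rw [length_shiftDesc, hc] at g3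
  generalize degens _ _ = s at *
  obtain ⟨N, x⟩ := s
  obtain rfl : N = w + 1 + p + q + 1 := by dsimp only at g3; omega
  refine ⟨x, rfl, g4.congr fun v hv => ?_⟩
  dsimp only at hv
  rcases le_or_gt v w with h | h
  · rw [jumpPath_of_le h, Finset.card_eq_zero.2]
    · split_ifs <;> omega
    · rw [Finset.filter_eq_empty_iff]
      intro x _; omega
  · obtain ⟨y, rfl⟩ : ∃ y, v = w + 1 + y := ⟨v - (w + 1), by omega⟩
    rw [jumpPath_add]
    have h1 := card_filter_sdiff hα (v := y) (by omega)
    have h2 : (α.filter (· + (w + 1) < w + 1 + y)).card = (α.filter (· < y)).card := by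
      congr 1
      exact Finset.filter_congr fun x _ => by omega
    rw [h2]
    split_ifs <;> omega

lemma swap_shiTerm {R : Type} [CommRing R] {m w p q : ℕ} (hm : m = w + 1 + p + q)
    (z : (X ⊗ X) _⦋m⦌) {α : Finset ℕ}
    (hα : α ⊆ Finset.range (p + q + 1)) (hc : α.card = p + 1) :
    ∃ x y : X _⦋m + 1⦌, swap R X (m + 1) (shiTerm R z q p α) =
        NChain.mk R (X ⊗ X) (m + 1) (Finsupp.single (pairing y x) 1) ∧
      IsPull ⟨m, z.1⟩ (jumpPath w w α) ⟨m + 1, x⟩ ∧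
      IsPull ⟨m, z.2⟩ (jumpPath w (w + 1 + p) (Finset.range (p + q + 1) \ α)) ⟨m + 1, y⟩ := by
  subst hm
  obtain ⟨x, hx, hx'⟩ := isPull_shi_fst z.1 hα hc
  obtain ⟨y, hy, hy'⟩ := isPull_shi_snd z.2 hα hc
  refine ⟨x, y, ?_, hx', hy'⟩
  rw [shiTerm, show w + 1 + p + q - p - q = w + 1 by omega, Nat.add_sub_cancel, Nat.add_sub_cancel,
    hx, hy, crossCls_mk, swap, NChain.map, NChain.desc_mk_single, one_smul]
  rfl

variable {j : ℕ}

/-- The functional `μ ⟨c ⊗ c, AW (t SHI)^n⟩` on chains of degree `m`. -/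
def shihEval (c : NCochain (ZMod 2) X j) (n m : ℕ) :
    NChain (ZMod 2) (X ⊗ X) m →ₗ[ZMod 2] ZMod 2 :=
  match n with
  | 0 => evTensor c c m ∘ₗ AW (ZMod 2) X X m
  | n + 1 => shihEval c n (m + 1) ∘ₗ swap (ZMod 2) X (m + 1) ∘ₗ SHI (ZMod 2) X X m

/-- `tSHIPow` peels off the last application of t SHI, whereas `shihEval` peels off the first. The
induction in `shihEval_mk` needs the latter, since it starts from an arbitrary simplex of the
product. -/
lemma shihEval_comp_tSHIPow (c : NCochain (ZMod 2) X j) (k m n : ℕ) :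
    shihEval c k (m + n) ∘ₗ tSHIPow (ZMod 2) X m n = shihEval c (k + n) m := by
  induction n generalizing k with
  | zero => rfl
  | succ n ih =>
    rw [show k + (n + 1) = (k + 1) + n by omega, ← ih (k + 1)]
    rfl

lemma vertsA_singleton {m k : ℕ} (hk : k ≤ m) : vertsA m {k} = Finset.range (k + 1) := by
  ext v
  rw [mem_vertsA, Finset.mem_singleton, Finset.mem_range, up, Finset.filter_singleton]
  split_ifs with h
  · simp; omega
  · simp; omega

lemma vertsB_singleton {m k : ℕ} : vertsB m {k} = Finset.Ico k (m + 1) := by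
  ext v
  rw [mem_vertsB, Finset.mem_singleton, Finset.mem_Ico, up, Finset.filter_singleton]
  split_ifs with h
  · simp; omega
  · simp; omega

lemma ev_faces_Ico (c : NCochain (ZMod 2) X j) {m : ℕ} (a : X _⦋m⦌) {k l : ℕ}
    (hl : l ≤ m + 1) (hkl : l - k ≤ m) :
    ev c (faces (List.Ico k l) ⟨m, a⟩) = evOn c a (Finset.range (m + 1) \ Finset.Ico k l) := by
  rw [ev_faces_sorted c a _ (List.Ico.pairwise_lt k l)
    (fun b hb => by have := (List.Ico.mem.1 hb).2; omega) (by rwa [List.Ico.length])]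
  congr 1
  ext x
  simp

/-- A single cut k gives A = {0, …, k}, which has the j + 1 vertices needed by c only for k = j;
this is the bidegree of AW that c ⊗ c sees. -/
lemma shihEval_zero_mk (c : NCochain (ZMod 2) X j) {m : ℕ} (hm : m = j + j) (z : (X ⊗ X) _⦋m⦌) :
    shihEval c 0 m (NChain.mk _ _ m (Finsupp.single z 1)) =
      ∑ I ∈ (Finset.range (m + 1)).powersetCard 1,
        evOn c z.1 (vertsA m I) * evOn c z.2 (vertsB m I) := by
  subst hm
  rw [Finset.powersetCard_one, Finset.sum_map, Finset.sum_eq_single j]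
  · rw [shihEval, LinearMap.comp_apply, AW, NChain.desc_mk_single, one_smul, evTensor, dif_pos rfl]
    change ev c (faces (List.Ico (j + 1) (j + j + 1)) _) * ev c (faces (List.Ico 0 j) _) = _
    rw [ev_faces_Ico c _ (by omega) (by omega), ev_faces_Ico c _ (by omega) (by omega)]
    simp only [Function.Embedding.coeFn_mk]
    rw [vertsA_singleton (by omega), vertsB_singleton]
    congr 2 <;> ext x <;> simp <;> omega
  · intro k hk hkj
    rw [Finset.mem_range] at hk
    simp only [Function.Embedding.coeFn_mk]
    rw [vertsA_singleton (by omega), evOn_eq_zero_of_card, zero_mul]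
    rw [Finset.card_range]
    omega
  · simp

/-- Subsets are sorted by their largest element. Used twice, this extracts the two top cuts. -/
lemma sum_powersetCard_succ {M : Type*} [AddCommMonoid M] (n N : ℕ) (f : Finset ℕ → M) :
    ∑ I ∈ (Finset.range N).powersetCard (n + 1), f I =
      ∑ v ∈ Finset.range N, ∑ J ∈ (Finset.range v).powersetCard n, f (insert v J) := by
  induction N with
  | zero => rw [Finset.powersetCard_eq_empty.2 (by simp)]; simp
  | succ N ih =>
    rw [Finset.sum_range_succ, ← ih, Finset.range_add_one,
      Finset.powersetCard_succ_insert (by simp), Finset.sum_union, Finset.sum_image]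
    · intro J hJ J' hJ' h
      have h1 : N ∉ J := fun h => by
        simpa using (Finset.mem_powersetCard.1 hJ).1 h
      have h2 : N ∉ J' := fun h => by
        simpa using (Finset.mem_powersetCard.1 hJ').1 h
      rw [← Finset.erase_insert h1, h, Finset.erase_insert h2]
    · refine Finset.disjoint_left.2 fun J hJ hJ' => ?_
      obtain ⟨J', -, rfl⟩ := Finset.mem_image.1 hJ'
      simpa using (Finset.mem_powersetCard.1 hJ).1 (Finset.mem_insert_self N J')

/-- For fixed p and q, all shuffles together contribute precisely the cut sets whose two largest
elements are w and w + 1 + p: by `shuffle_unique` only one shuffle survives, and its surviving cut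
sets are parametrized by the cuts below w. -/
lemma sum_shuffles (c : NCochain (ZMod 2) X j) {m n w p q : ℕ} (hm : m = w + 1 + p + q)
    (z : (X ⊗ X) _⦋m⦌)
    (ih : ∀ x y : X _⦋m + 1⦌,
      shihEval c n (m + 1) (NChain.mk _ _ (m + 1) (Finsupp.single (pairing x y) 1)) =
        ∑ I ∈ (Finset.range (m + 1 + 1)).powersetCard (n + 1),
          evOn c x (vertsA (m + 1) I) * evOn c y (vertsB (m + 1) I)) :
    ∑ α ∈ (Finset.range (p + q + 1)).powersetCard (p + 1),
        shihEval c n (m + 1) (swap (ZMod 2) X (m + 1) (shiTerm (ZMod 2) z q p α)) =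
      ∑ J ∈ (Finset.range w).powersetCard n,
        evOn c z.1 (vertsA m (insert (w + 1 + p) (insert w J))) *
          evOn c z.2 (vertsB m (insert (w + 1 + p) (insert w J))) := by
  subst hm
  have hsub : ∀ I : Finset ℕ, vertsA (w + 1 + p + q + 1) I ⊆ Finset.range (w + 1 + p + q + 1 + 1) :=
    fun I => Finset.filter_subset _ _
  have hsub' : ∀ I : Finset ℕ,
      vertsB (w + 1 + p + q + 1) I ⊆ Finset.range (w + 1 + p + q + 1 + 1) :=
    fun I => Finset.filter_subset _ _
  have hmem : Finset.Ico q (p + q + 1) ∈ (Finset.range (p + q + 1)).powersetCard (p + 1) := by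
    rw [Finset.mem_powersetCard, Nat.card_Ico]
    exact ⟨fun x hx => Finset.mem_range.2 (Finset.mem_Ico.1 hx).2, by omega⟩
  rw [Finset.sum_eq_single_of_mem _ hmem]
  · obtain ⟨x, y, e, hx, hy⟩ :=
      swap_shiTerm (R := ZMod 2) rfl z (Finset.mem_powersetCard.1 hmem).1
        (Finset.mem_powersetCard.1 hmem).2
    rw [range_sdiff_Ico] at hy
    rw [e, ih]
    have hins : Set.InjOn (insert (w + 1 + q))
        ((Finset.range w).powersetCard n : Set (Finset ℕ)) := by
      intro J hJ J' hJ' h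
      have hn : ∀ J ∈ (Finset.range w).powersetCard n, w + 1 + q ∉ J := fun J hJ h => by
        have := Finset.mem_range.1 ((Finset.mem_powersetCard.1 hJ).1 h)
        omega
      rw [← Finset.erase_insert (hn J hJ), h, Finset.erase_insert (hn J' hJ')]
    -- Restrict to the cut sets {w + 1 + q} ∪ J with J below w. For any other set one of the two
    -- paths fails to be injective and its factor vanishes.
    rw [← Finset.sum_subset (s₁ := ((Finset.range w).powersetCard n).image (insert (w + 1 + q))),
      Finset.sum_image hins]
    · refine Finset.sum_congr rfl fun J hJ => ?_
      have hJ' := (Finset.mem_powersetCard.1 hJ).1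
      obtain ⟨a1, a2⟩ := jumpPath_vertsA (p := p) (q := q) hJ'
      obtain ⟨b1, b2⟩ := jumpPath_vertsB (p := p) (q := q) hJ'
      rw [(evOn_of_isPull c hy (hsub _)).1 a1, (evOn_of_isPull c hx (hsub' _)).1 b1, a2, b2,
        mul_comm]
    · intro I hI
      obtain ⟨J, hJ, rfl⟩ := Finset.mem_image.1 hI
      obtain ⟨h1, h2⟩ := Finset.mem_powersetCard.1 hJ
      rw [Finset.mem_powersetCard, Finset.card_insert_of_notMem, h2]
      · refine ⟨fun i hi => ?_, rfl⟩
        rw [Finset.mem_range]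
        rcases Finset.mem_insert.1 hi with rfl | hi
        · omega
        · have := Finset.mem_range.1 (h1 hi); omega
      · intro h
        have := Finset.mem_range.1 (h1 h); omega
    · intro I hI hI'
      obtain ⟨h1, h2⟩ := Finset.mem_powersetCard.1 hI
      by_cases hA : Set.InjOn (jumpPath w (w + 1 + p) (Finset.range q))
          (vertsA (w + 1 + p + q + 1) I)
      · by_cases hB : Set.InjOn (jumpPath w w (Finset.Ico q (p + q + 1)))
            (vertsB (w + 1 + p + q + 1) I)
        · obtain ⟨α1, α2⟩ := Finset.mem_powersetCard.1 hmem
          obtain ⟨-, J, hJ, rfl⟩ := shuffle_unique α1 α2 h1 (by rwa [range_sdiff_Ico]) hB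
          refine (hI' (Finset.mem_image.2 ⟨J, Finset.mem_powersetCard.2 ⟨hJ, ?_⟩, rfl⟩)).elim
          rw [Finset.card_insert_of_notMem] at h2
          · omega
          · intro h
            have := Finset.mem_range.1 (hJ h); omega
        · rw [(evOn_of_isPull c hx (hsub' _)).2 hB, mul_zero]
      · rw [(evOn_of_isPull c hy (hsub _)).2 hA, zero_mul]
  · intro α hα hne
    obtain ⟨α1, α2⟩ := Finset.mem_powersetCard.1 hα
    obtain ⟨x, y, e, hx, hy⟩ := swap_shiTerm (R := ZMod 2) rfl z α1 α2
    rw [e, ih]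
    refine Finset.sum_eq_zero fun I hI => ?_
    by_cases hA : Set.InjOn (jumpPath w (w + 1 + p) (Finset.range (p + q + 1) \ α))
        (vertsA (w + 1 + p + q + 1) I)
    · by_cases hB : Set.InjOn (jumpPath w w α) (vertsB (w + 1 + p + q + 1) I)
      · exact (hne (shuffle_unique α1 α2 (Finset.mem_powersetCard.1 hI).1 hA hB).1).elim
      · rw [(evOn_of_isPull c hx (hsub' _)).2 hB, mul_zero]
    · rw [(evOn_of_isPull c hy (hsub _)).2 hA, zero_mul]

lemma neg_one_pow_smul (k : ℕ) {M : Type*} [AddCommGroup M] [Module (ZMod 2) M] (x : M) :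
    (-1 : ZMod 2) ^ k • x = x := by
  rw [show (-1 : ZMod 2) = 1 from rfl, one_pow, one_smul]

/-- The composite `AW (t SHI)^n` on an arbitrary simplex of `X × X`, evaluated on `c ⊗ c`. -/
theorem shihEval_mk (c : NCochain (ZMod 2) X j) {m n : ℕ} (hmn : m + n = j + j)
    (z : (X ⊗ X) _⦋m⦌) :
    shihEval c n m (NChain.mk _ _ m (Finsupp.single z 1)) =
      ∑ I ∈ (Finset.range (m + 1)).powersetCard (n + 1),
        evOn c z.1 (vertsA m I) * evOn c z.2 (vertsB m I) := by
  induction n generalizing m with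
  | zero => exact shihEval_zero_mk c hmn z
  | succ n ih =>
    rw [shihEval, LinearMap.comp_apply, LinearMap.comp_apply, SHI, NChain.desc_mk_single, one_smul]
    simp only [map_sum, neg_one_pow_smul]
    -- The largest cut cannot be 0, since further cuts must lie below it. Reversing the sum over `q`
    -- matches it with m - q; reversing the sum over `p`, further down, matches the second largest
    -- cut with w = m - q - p - 1.
    rw [sum_powersetCard_succ, Finset.sum_range_succ']
    simp only [Finset.range_zero]
    rw [Finset.powersetCard_eq_empty.2 (by simp), Finset.sum_empty, add_zero,
      ← Finset.sum_range_reflect]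
    refine Finset.sum_congr rfl fun q hq => ?_
    rw [Finset.mem_range] at hq
    rw [sum_powersetCard_succ, ← Finset.sum_range_reflect, show m - (m - 1 - q) = q + 1 by omega]
    refine Finset.sum_congr rfl fun w hw => ?_
    rw [Finset.mem_range] at hw
    rw [show q + 1 - 1 - w = q - w by omega, sum_shuffles c (w := w) (n := n) (by omega) z
      (fun x y => ih (by omega) (pairing x y)), show w + 1 + (q - w) = q + 1 by omega]

end ShihOperator

/-! ### From sums over cut sets to nested sums with the limits S(k) -/

section NestedSums

/-- `0 ≤ i_0 < i_1 < ⋯ < i_n ≤ m`. -/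
def IsTuple (n m : ℕ) (ι : ℕ → ℤ) : Prop :=
  0 ≤ ι 0 ∧ (∀ l < n, ι l < ι (l + 1)) ∧ ι n ≤ m

/-- The set of the entries of a tuple with indices in `s`. -/
def entries (ι : ℕ → ℤ) (s : Finset ℕ) : Finset ℕ := s.image fun l => (ι l).toNat

lemma entries_congr {ι ι' : ℕ → ℤ} {s : Finset ℕ} (h : ∀ l ∈ s, ι l = ι' l) :
    entries ι s = entries ι' s :=
  Finset.image_congr fun l hl => by rw [h l hl]

lemma lowerBound_congr {n m k : ℕ} {ι ι' : ℕ → ℤ} (h : ∀ l, k < l → l ≤ n → ι l = ι' l) :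
    lowerBound n m ι k = lowerBound n m ι' k := by
  unfold lowerBound
  rw [Finset.sum_congr rfl fun l hl => by
    rw [h l (Finset.mem_Ioc.1 hl).1 (Finset.mem_Ioc.1 hl).2]]

lemma lowerBound_self (n m : ℕ) (ι : ℕ → ℤ) :
    lowerBound n m ι n = ((m + 1) / 2 : ℕ) + (n / 2 : ℕ) := by
  simp [lowerBound, ← two_mul]

/-- In S(k) + S(k+1) the alternating sums cancel except for i_{k+1}, and the two floors add up to k.
All inequalities for S follow from this recurrence. -/
lemma lowerBound_add_succ {n m k : ℕ} (ι : ℕ → ℤ) (hk : k < n) :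
    lowerBound n m ι k + lowerBound n m ι (k + 1) = ι (k + 1) + k := by
  unfold lowerBound
  have e : Finset.Ioc k n = insert (k + 1) (Finset.Ioc (k + 1) n) := by
    ext x; simp only [Finset.mem_Ioc, Finset.mem_insert]; omega
  rw [e, Finset.sum_insert (by simp)]
  have e1 : (-1 : ℤ) ^ (k + (k + 1) + 1) = 1 := Even.neg_one_pow ⟨k + 1, by ring⟩
  have e2 : ∑ l ∈ Finset.Ioc (k + 1) n, (-1 : ℤ) ^ (k + 1 + l + 1) * ι l =
      -∑ l ∈ Finset.Ioc (k + 1) n, (-1 : ℤ) ^ (k + l + 1) * ι l := by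
    rw [← Finset.sum_neg_distrib]
    exact Finset.sum_congr rfl fun l _ => by ring
  have e3 : (-1 : ℤ) ^ (k + 1 + n) = - (-1) ^ (k + n) := by ring
  rw [e1, e2, e3]
  have e4 : ((k / 2 : ℕ) : ℤ) + (((k + 1) / 2 : ℕ) : ℤ) = k := by omega
  linear_combination e4

/-- S(k) = i_{k+1} + k - S(k+1), so i_{k+1} ≥ S(k+1) gives S(k) ≥ k. In the same way,
`lowerBound_lt` deduces S(k) < i_{k+1} from S(k+1) ≥ k + 1. -/
lemma le_lowerBound {n m k : ℕ} (hnm : n ≤ m) (hk : k ≤ n) {ι : ℕ → ℤ}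
    (h : ∀ l, k < l → l ≤ n → lowerBound n m ι l ≤ ι l) : (k : ℤ) ≤ lowerBound n m ι k := by
  rcases hk.eq_or_lt with rfl | hk
  · rw [lowerBound_self]; omega
  · have := lowerBound_add_succ (m := m) ι hk
    have := h (k + 1) (by omega) hk
    omega

lemma lowerBound_lt {n m k : ℕ} (hnm : n ≤ m) (hk : k ≤ n) {ι : ℕ → ℤ} (h0 : ι (n + 1) = m + 1)
    (h : ∀ l, k < l → l ≤ n → lowerBound n m ι l ≤ ι l) : lowerBound n m ι k < ι (k + 1) := by
  rcases hk.eq_or_lt with rfl | hk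
  · rw [lowerBound_self, h0]; omega
  · have := lowerBound_add_succ (m := m) ι hk
    have := le_lowerBound hnm (Nat.succ_le_of_lt hk) fun l hl => h l (by omega)
    rw [Nat.succ_eq_add_one] at this
    push_cast at this
    omega

/-- Upward induction with S(k+1) = i_{k+1} + k - S(k): the bound S(k) ≥ k yields S(k+1) ≤ i_{k+1},
and S(k) ≤ i_k < i_{k+1} yields S(k+1) > k. -/
lemma IsTuple.lowerBound_le {n m : ℕ} {ι : ℕ → ℤ} (h : IsTuple n m ι)
    (h0 : ι 0 = lowerBound n m ι 0) {k : ℕ} (hk : k ≤ n) :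
    (k : ℤ) ≤ lowerBound n m ι k ∧ lowerBound n m ι k ≤ ι k := by
  induction k with
  | zero => exact ⟨by have := h.1; push_cast; omega, h0.ge⟩
  | succ k ih =>
    obtain ⟨i1, i2⟩ := ih (by omega)
    have := lowerBound_add_succ (m := m) ι hk
    have := h.2.1 k hk
    push_cast
    omega

/-- Replace the first entries of a tuple by the elements of `J`, in increasing order. -/
lemma exists_tuple_prefix {n m k : ℕ} (hk : k ≤ n) {ι : ℕ → ℤ} (h0 : ι (n + 1) = m + 1)
    (h : ∀ l, k < l → l ≤ n → ι l < ι (l + 1)) {J : Finset ℕ} (hJ : ∀ x ∈ J, (x : ℤ) < ι (k + 1))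
    (hc : J.card = k + 1) :
    ∃ ι' : ℕ → ℤ, IsTuple n m ι' ∧ (∀ l, k < l → ι' l = ι l) ∧
      entries ι' (Finset.range (n + 1)) = J ∪ entries ι (Finset.Ioc k n) ∧
      (∀ v ∈ J, (∀ x ∈ J, x ≤ v) → ι' k = v) := by
  have hmono := (J.orderEmbOfFin hc).strictMono
  have hmem := J.orderEmbOfFin_mem hc
  have hrange := J.range_orderEmbOfFin hc
  generalize (J.orderEmbOfFin hc : Fin (k + 1) → ℕ) = g at hmono hmem hrange
  let ι' : ℕ → ℤ := fun l => if h : l < k + 1 then g ⟨l, h⟩ else ι l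
  have e1 : ∀ l (h : l < k + 1), ι' l = g ⟨l, h⟩ := fun l h => dif_pos h
  have e2 : ∀ l, k < l → ι' l = ι l := fun l h => dif_neg (by omega)
  refine ⟨ι', ⟨?_, ?_, ?_⟩, e2, ?_, ?_⟩
  · rw [e1 0 (by omega)]; omega
  · intro l hl
    rcases lt_trichotomy l k with h1 | rfl | h1
    · rw [e1 l (by omega), e1 (l + 1) (by omega)]
      have : (⟨l, by omega⟩ : Fin (k + 1)) < ⟨l + 1, by omega⟩ := Nat.lt_succ_self l
      exact_mod_cast hmono this
    · rw [e1 l (by omega), e2 (l + 1) (by omega)]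
      exact hJ _ (hmem _)
    · rw [e2 l h1, e2 (l + 1) (by omega)]
      exact h l h1 hl.le
  · rcases hk.eq_or_lt with rfl | hk
    · rw [e1 k (by omega)]
      have := hJ _ (hmem ⟨k, by omega⟩)
      omega
    · rw [e2 n hk]
      have := h n hk le_rfl
      omega
  · ext x
    simp only [entries, Finset.mem_union, Finset.mem_image, Finset.mem_range, Finset.mem_Ioc]
    constructor
    · rintro ⟨l, hl, rfl⟩
      rcases le_or_gt l k with h1 | h1
      · left
        rw [e1 l (by omega), Int.toNat_natCast]
        exact hmem _
      · exact Or.inr ⟨l, by omega, by rw [e2 l h1]⟩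
    · rintro (hx | ⟨l, hl, rfl⟩)
      · rw [← Finset.mem_coe, ← hrange] at hx
        obtain ⟨⟨l, hl⟩, rfl⟩ := hx
        exact ⟨l, by omega, by rw [e1 l hl, Int.toNat_natCast]⟩
      · exact ⟨l, by omega, by rw [e2 l hl.1]⟩
  · intro v hv hmax
    rw [e1 k (by omega)]
    rw [← Finset.mem_coe, ← hrange] at hv
    obtain ⟨l, rfl⟩ := hv
    have h1 := hmax _ (hmem ⟨k, by omega⟩)
    have h2 := hmono.monotone (show l ≤ ⟨k, by omega⟩ from Nat.lt_succ_iff.1 l.2)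
    exact_mod_cast le_antisymm h1 h2

variable {n m : ℕ} {F : (ℕ → ℤ) → ZMod 2} {T : Finset ℕ → ZMod 2}

/-- Complete v and J to a full increasing tuple. A nonzero value forces i_0 = S(0) there, hence S(k)
≤ i_k = v, and S(k) depends only on the entries beyond k, which have not changed. -/
lemma lowerBound_le_of_ne_zero
    (hF : ∀ ι, IsTuple n m ι → F ι = T (entries ι (Finset.range (n + 1))))
    (hdim : ∀ ι, IsTuple n m ι → F ι ≠ 0 → ι 0 = lowerBound n m ι 0)
    {k : ℕ} (hk : k ≤ n) {ι : ℕ → ℤ} (h0 : ι (n + 1) = m + 1)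
    (h1 : ∀ l, k < l → l ≤ n → ι l < ι (l + 1))
    {v : ℕ} (hv : (v : ℤ) < ι (k + 1)) {J : Finset ℕ} (hJ : J ∈ (Finset.range v).powersetCard k)
    (hT : T (insert v J ∪ entries ι (Finset.Ioc k n)) ≠ 0) :
    lowerBound n m ι k ≤ v ∧ (k = 0 → lowerBound n m ι 0 = v) := by
  obtain ⟨hJ, hc⟩ := Finset.mem_powersetCard.1 hJ
  have hJ' : ∀ x ∈ J, x < v := fun x hx => Finset.mem_range.1 (hJ hx)
  have hvJ : v ∉ J := fun h => lt_irrefl _ (hJ' v h)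
  obtain ⟨ι', a1, a2, a3, a4⟩ := exists_tuple_prefix (J := insert v J) hk h0 h1
    (fun x hx => by
      rcases Finset.mem_insert.1 hx with rfl | hx
      · exact hv
      · have := hJ' x hx; omega)
    (by rw [Finset.card_insert_of_notMem hvJ, hc])
  have a5 := a4 v (Finset.mem_insert_self _ _) (fun x hx => by
    rcases Finset.mem_insert.1 hx with rfl | hx
    · exact le_rfl
    · exact (hJ' x hx).le)
  rw [← a3, ← hF ι' a1] at hT
  have hd := hdim ι' a1 hT
  have a6 : lowerBound n m ι k = lowerBound n m ι' k :=
    lowerBound_congr fun l hl _ => (a2 l hl).symm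
  refine ⟨?_, ?_⟩
  · rw [a6, ← a5]
    exact (a1.lowerBound_le hd hk).2
  · rintro rfl
    rw [a6, ← hd, a5]

/-- With i_{k+1}, …, i_n fixed, the inner nested sum equals the unrestricted sum over all choices of
k + 1 smaller cuts: each lower limit removes zero terms only, and at the last level only i_0 = S(0)
survives. -/
lemma innerSum_eq (hnm : n ≤ m)
    (hF : ∀ ι, IsTuple n m ι → F ι = T (entries ι (Finset.range (n + 1))))
    (hdim : ∀ ι, IsTuple n m ι → F ι ≠ 0 → ι 0 = lowerBound n m ι 0)
    {k : ℕ} (hk : k ≤ n) {ι : ℕ → ℤ} (h0 : ι (n + 1) = m + 1)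
    (h1 : ∀ l, k < l → l ≤ n → ι l < ι (l + 1))
    (h2 : ∀ l, k < l → l ≤ n → lowerBound n m ι l ≤ ι l) :
    innerSum n m F k ι = ∑ J ∈ (Finset.range (ι (k + 1)).toNat).powersetCard (k + 1),
      T (J ∪ entries ι (Finset.Ioc k n)) := by
  induction k generalizing ι with
  | zero =>
    have hlb := le_lowerBound hnm hk h2
    have hlt := lowerBound_lt hnm hk h0 h2
    rw [sum_powersetCard_succ]
    obtain ⟨v, hv⟩ := Int.eq_ofNat_of_zero_le (by simpa using hlb)
    rw [Finset.sum_eq_single_of_mem v (by rw [Finset.mem_range]; omega)]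
    · rw [innerSum, Finset.powersetCard_zero, Finset.sum_singleton, hv]
      have hc : ∀ l, 0 < l → Function.update ι 0 (v : ℤ) l = ι l := fun l hl =>
        Function.update_of_ne hl.ne' _ _
      rw [hF]
      · congr 1
        ext x
        simp only [entries, insert_empty_eq, Finset.mem_union, Finset.mem_singleton,
          Finset.mem_image, Finset.mem_range, Finset.mem_Ioc]
        constructor
        · rintro ⟨l, hl, rfl⟩
          rcases Nat.eq_zero_or_pos l with rfl | hl'
          · simp
          · exact Or.inr ⟨l, by omega, by rw [hc l hl']⟩
        · rintro (rfl | ⟨l, hl, rfl⟩)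
          · exact ⟨0, by omega, by simp⟩
          · exact ⟨l, by omega, by rw [hc l hl.1]⟩
      · refine ⟨by simp, fun l hl => ?_, ?_⟩
        · rw [hc (l + 1) (by omega)]
          rcases Nat.eq_zero_or_pos l with rfl | hl'
          · simpa using hv ▸ hlt
          · rw [hc l hl']
            exact h1 l hl' hl.le
        · rcases Nat.eq_zero_or_pos n with rfl | hn
          · rw [Function.update_self]
            simp only [zero_add] at h0 hlt
            omega
          · rw [hc n hn]
            have := h1 n hn le_rfl
            omega
    · intro v' hv' hne
      rw [Finset.mem_range] at hv'
      refine Finset.sum_eq_zero fun J hJ => ?_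
      by_contra hT
      have := (lowerBound_le_of_ne_zero hF hdim hk h0 h1 (by omega) hJ hT).2 rfl
      omega
  | succ k ih =>
    have hlb := le_lowerBound hnm hk h2
    have hlt := lowerBound_lt hnm hk h0 h2
    rw [sum_powersetCard_succ, innerSum, show k + 2 = k + 1 + 1 from rfl]
    -- Discard the largest remaining cuts below S(k + 1); by `lowerBound_le_of_ne_zero` their terms
    -- vanish.
    rw [← Finset.sum_filter_of_ne (p := fun v : ℕ => lowerBound n m ι (k + 1) ≤ v)]
    · refine Finset.sum_nbij' (fun v => v.toNat) (fun v => (v : ℤ)) ?_ ?_ ?_ ?_ ?_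
      · intro v hv
        rw [Finset.mem_Icc] at hv
        rw [Finset.mem_filter, Finset.mem_range]
        push_cast at hlb
        omega
      · intro v hv
        rw [Finset.mem_filter, Finset.mem_range] at hv
        rw [Finset.mem_Icc]
        omega
      · intro v hv
        rw [Finset.mem_Icc] at hv
        push_cast at hlb
        omega
      · intro v hv
        simp
      · intro v hv
        rw [Finset.mem_Icc] at hv
        push_cast at hlb
        obtain ⟨v, rfl⟩ := Int.eq_ofNat_of_zero_le (show 0 ≤ v by omega)
        have hc : ∀ l, k + 1 < l → Function.update ι (k + 1) (v : ℤ) l = ι l := fun l hl =>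
          Function.update_of_ne (by omega) _ _
        rw [ih (by omega)]
        · rw [Function.update_self, Int.toNat_natCast]
          refine Finset.sum_congr rfl fun J _ => ?_
          congr 1
          have e : Finset.Ioc k n = insert (k + 1) (Finset.Ioc (k + 1) n) := by
            ext x; simp only [Finset.mem_Ioc, Finset.mem_insert]; omega
          rw [← entries_congr fun l hl => hc l (Finset.mem_Ioc.1 hl).1, e, entries, entries,
            Finset.image_insert, Function.update_self, Int.toNat_natCast, Finset.insert_union,
            Finset.union_insert]
        · rw [hc _ (by omega), h0]
        · intro l hl hln
          rw [hc (l + 1) (by omega)]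
          rcases (show k + 1 ≤ l from hl).eq_or_lt with rfl | hl
          · rw [Function.update_self]
            omega
          · rw [hc l hl]
            exact h1 l hl hln
        · intro l hl hln
          rw [
            lowerBound_congr fun l' hl' _ => hc l' (by omega)]
          rcases (show k + 1 ≤ l from hl).eq_or_lt with rfl | hl
          · rw [Function.update_self]
            omega
          · rw [hc l hl]
            exact h2 l hl hln
    · intro v hv hne
      rw [Finset.mem_range] at hv
      obtain ⟨J, hJ, hT⟩ := Finset.exists_ne_zero_of_sum_ne_zero hne
      exact (lowerBound_le_of_ne_zero hF hdim hk h0 h1 (by omega) hJ hT).1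

lemma nestedSum_eq (hnm : n ≤ m)
    (hF : ∀ ι, IsTuple n m ι → F ι = T (entries ι (Finset.range (n + 1))))
    (hdim : ∀ ι, IsTuple n m ι → F ι ≠ 0 → ι 0 = lowerBound n m ι 0) :
    nestedSum n m F = ∑ I ∈ (Finset.range (m + 1)).powersetCard (n + 1), T I := by
  -- At level n no entry has been chosen, so the constant starting tuple matters only through the
  -- sentinel i_{n+1} = m + 1 and the inequalities are vacuous.
  rw [nestedSum, innerSum_eq hnm hF hdim le_rfl rfl (fun l h h' => by omega)
    (fun l h h' => by omega), show ((m : ℤ) + 1).toNat = m + 1 by omega]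
  simp [entries]

end NestedSums

/-! ### Which vertices the words of face operators delete -/

section Words

variable {n m : ℕ} {ι : ℕ → ℤ}

lemma IsTuple.lt (h : IsTuple n m ι) {l l' : ℕ} (hl : l < l') (hl' : l' ≤ n) : ι l < ι l' := by
  induction l', hl using Nat.le_induction with
  | base => exact h.2.1 l hl'
  | succ k hk ih => exact (ih (by omega)).trans (h.2.1 k hl')

lemma IsTuple.nonneg (h : IsTuple n m ι) {l : ℕ} (hl : l ≤ n) : 0 ≤ ι l := by
  rcases Nat.eq_zero_or_pos l with rfl | hl'
  · exact h.1
  · exact h.1.trans (h.lt hl' hl).le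

lemma IsTuple.le (h : IsTuple n m ι) {l : ℕ} (hl : l ≤ n) : ι l ≤ m := by
  rcases hl.eq_or_lt with rfl | hl'
  · exact h.2.2
  · exact (h.lt hl' le_rfl).le.trans h.2.2

lemma IsTuple.mem_entries (h : IsTuple n m ι) {v : ℕ} :
    v ∈ entries ι (Finset.range (n + 1)) ↔ ∃ l ≤ n, ι l = v := by
  simp only [entries, Finset.mem_image, Finset.mem_range, Nat.lt_succ_iff]
  refine exists_congr fun l => and_congr_right fun hl => ?_
  have := h.nonneg hl
  omega

/-- The index k is that of the first entry above v. Thus the position of v among the cuts determines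
the parity that assigns v to A or B. -/
lemma IsTuple.up_eq (h : IsTuple n m ι) {v k : ℕ} (hk : ∀ l ≤ n, (v : ℤ) < ι l ↔ k ≤ l) :
    up (entries ι (Finset.range (n + 1))) v = n + 1 - k := by
  have e : (entries ι (Finset.range (n + 1))).filter (v < ·) = entries ι (Finset.Ico k (n + 1)) := by
    ext x
    rw [Finset.mem_filter, h.mem_entries]
    simp only [entries, Finset.mem_image, Finset.mem_Ico]
    constructor
    · rintro ⟨⟨l, hl, hx⟩, hv⟩
      exact ⟨l, ⟨(hk l hl).1 (by omega), by omega⟩, by omega⟩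
    · rintro ⟨l, ⟨h1, h2⟩, rfl⟩
      have := h.nonneg (l := l) (by omega)
      have := (hk l (by omega)).2 h1
      exact ⟨⟨l, by omega, by omega⟩, by omega⟩
  rw [up, e, entries, Finset.card_image_of_injOn, Nat.card_Ico]
  intro x hx y hy hxy
  simp only [Finset.coe_Ico, Set.mem_Ico] at hx hy hxy
  have h1 := h.nonneg (l := x) (by omega)
  have h2 := h.nonneg (l := y) (by omega)
  rcases lt_trichotomy x y with h3 | h3 | h3
  · have := h.lt h3 (by omega); omega
  · exact h3
  · have := h.lt h3 (by omega); omega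

lemma IsTuple.up_of_lt (h : IsTuple n m ι) {v : ℕ} (hv : (v : ℤ) < ι 0) :
    v ∉ entries ι (Finset.range (n + 1)) ∧ up (entries ι (Finset.range (n + 1))) v = n + 1 := by
  have h1 : ∀ l ≤ n, (v : ℤ) < ι l := fun l hl => by
    rcases Nat.eq_zero_or_pos l with rfl | hl'
    · exact hv
    · exact hv.trans (h.lt hl' hl)
  refine ⟨fun hm => ?_, h.up_eq (k := 0) fun l hl => by simp [h1 l hl]⟩
  obtain ⟨l, hl, e⟩ := h.mem_entries.1 hm
  have := h1 l hl
  omega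

lemma IsTuple.up_of_gt (h : IsTuple n m ι) {v : ℕ} (hv : ι n < v) :
    v ∉ entries ι (Finset.range (n + 1)) ∧ up (entries ι (Finset.range (n + 1))) v = 0 := by
  have h1 : ∀ l ≤ n, ι l < v := fun l hl => by
    rcases hl.eq_or_lt with rfl | hl'
    · exact hv
    · exact (h.lt hl' le_rfl).trans hv
  refine ⟨fun hm => ?_, ?_⟩
  · obtain ⟨l, hl, e⟩ := h.mem_entries.1 hm
    have := h1 l hl
    omega
  · rw [h.up_eq (k := n + 1), Nat.sub_self]
    intro l hl
    have := h1 l hl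
    omega

lemma IsTuple.up_of_between (h : IsTuple n m ι) {v k : ℕ} (hk : k < n) (h1 : ι k < v)
    (h2 : (v : ℤ) < ι (k + 1)) :
    v ∉ entries ι (Finset.range (n + 1)) ∧ up (entries ι (Finset.range (n + 1))) v = n - k := by
  have h3 : ∀ l ≤ n, k < l → (v : ℤ) < ι l := fun l hl hkl => by
    rcases (show k + 1 ≤ l from hkl).eq_or_lt with rfl | hl'
    · exact h2
    · exact h2.trans (h.lt hl' hl)
  have h4 : ∀ l ≤ n, l ≤ k → ι l < v := fun l hl hlk => by
    rcases hlk.eq_or_lt with rfl | hl'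
    · exact h1
    · exact (h.lt hl' hk.le).trans h1
  refine ⟨fun hm => ?_, ?_⟩
  · obtain ⟨l, hl, e⟩ := h.mem_entries.1 hm
    rcases le_or_gt l k with h5 | h5
    · have := h4 l hl h5; omega
    · have := h3 l hl h5; omega
  · rw [h.up_eq (k := k + 1)]
    · omega
    · intro l hl
      rcases le_or_gt l k with h5 | h5
      · have := h4 l hl h5; omega
      · have := h3 l hl h5; omega

lemma IsTuple.cases (h : IsTuple n m ι) {v : ℕ} (hv : v ∉ entries ι (Finset.range (n + 1))) :
    (v : ℤ) < ι 0 ∨ (∃ k < n, ι k < v ∧ (v : ℤ) < ι (k + 1)) ∨ ι n < v := by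
  by_contra! hcon
  obtain ⟨h1, h2, h3⟩ := hcon
  have hne : ∀ l ≤ n, ι l ≠ v := fun l hl e => hv (h.mem_entries.2 ⟨l, hl, e⟩)
  have : ∀ l ≤ n, ι l < v := by
    intro l hl
    induction l with
    | zero => have := hne 0 hl; omega
    | succ l ih =>
      have := h2 l hl (ih (by omega))
      have := hne (l + 1) hl
      omega
  have := this n le_rfl
  omega

lemma mem_block {a b : ℤ} (ha : 0 ≤ a) {v : ℕ} : v ∈ block a b ↔ a ≤ v ∧ (v : ℤ) ≤ b := by
  rw [block, List.Ico.mem]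
  omega

lemma pairwise_block (a b : ℤ) : (block a b).Pairwise (· < ·) := List.Ico.pairwise_lt _ _

lemma length_block {a b : ℤ} (ha : 0 ≤ a) (hb : a ≤ b + 1) :
    ((block a b).length : ℤ) = b + 1 - a := by
  rw [block, List.Ico.length]
  omega

/-- The concatenation of the interiors of the blocks `[i_0, i_1], [i_2, i_3], …`. -/
abbrev lowerBlocks (t : ℕ) (ι : ℕ → ℤ) : List ℕ :=
  (List.range t).flatMap fun k => block (ι (2 * k) + 1) (ι (2 * k + 1) - 1)

/-- The concatenation of the interiors of the blocks `[i_1, i_2], [i_3, i_4], …`. -/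
abbrev upperBlocks (t : ℕ) (ι : ℕ → ℤ) : List ℕ :=
  (List.range t).flatMap fun k => block (ι (2 * k + 1) + 1) (ι (2 * k + 2) - 1)

lemma IsTuple.mem_lowerBlocks (h : IsTuple n m ι) {t : ℕ} (ht : 2 * t ≤ n + 1) {v : ℕ} :
    v ∈ lowerBlocks t ι ↔ ∃ k < t, ι (2 * k) < v ∧ (v : ℤ) < ι (2 * k + 1) := by
  rw [List.mem_flatMap]
  simp only [List.mem_range]
  refine exists_congr fun k => and_congr_right fun hk => ?_
  have := h.nonneg (l := 2 * k) (by omega)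
  rw [mem_block (by omega)]
  omega

lemma IsTuple.mem_upperBlocks (h : IsTuple n m ι) {t : ℕ} (ht : 2 * t ≤ n) {v : ℕ} :
    v ∈ upperBlocks t ι ↔ ∃ k < t, ι (2 * k + 1) < v ∧ (v : ℤ) < ι (2 * k + 2) := by
  rw [List.mem_flatMap]
  simp only [List.mem_range]
  refine exists_congr fun k => and_congr_right fun hk => ?_
  have := h.nonneg (l := 2 * k + 1) (by omega)
  rw [mem_block (by omega)]
  omega

lemma IsTuple.pairwise_lowerBlocks (h : IsTuple n m ι) {t : ℕ} (ht : 2 * t ≤ n + 1) :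
    (lowerBlocks t ι).Pairwise (· < ·) := by
  rw [List.pairwise_flatMap]
  refine ⟨fun k _ => pairwise_block _ _, List.pairwise_lt_range.imp_of_mem ?_⟩
  intro k k' hk hk' hkk' x hx y hy
  rw [List.mem_range] at hk hk'
  have h1 := h.nonneg (l := 2 * k) (by omega)
  have h2 := h.nonneg (l := 2 * k') (by omega)
  have h3 := h.lt (l := 2 * k + 1) (l' := 2 * k') (by omega) (by omega)
  rw [mem_block (by omega)] at hx hy
  omega

lemma IsTuple.pairwise_upperBlocks (h : IsTuple n m ι) {t : ℕ} (ht : 2 * t ≤ n) :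
    (upperBlocks t ι).Pairwise (· < ·) := by
  rw [List.pairwise_flatMap]
  refine ⟨fun k _ => pairwise_block _ _, List.pairwise_lt_range.imp_of_mem ?_⟩
  intro k k' hk hk' hkk' x hx y hy
  rw [List.mem_range] at hk hk'
  have h1 := h.nonneg (l := 2 * k + 1) (by omega)
  have h2 := h.nonneg (l := 2 * k' + 1) (by omega)
  have h3 := h.lt (l := 2 * k + 2) (l' := 2 * k' + 1) (by omega) (by omega)
  rw [mem_block (by omega)] at hx hy
  omega

lemma IsTuple.length_lowerBlocks (h : IsTuple n m ι) {t : ℕ} (ht : 2 * t ≤ n + 1) :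
    ((lowerBlocks t ι).length : ℤ) = ∑ k ∈ Finset.range t, (ι (2 * k + 1) - ι (2 * k)) - t := by
  induction t with
  | zero => simp
  | succ t ih =>
    have h1 := h.nonneg (l := 2 * t) (by omega)
    have h2 := h.lt (l := 2 * t) (l' := 2 * t + 1) (by omega) (by omega)
    rw [lowerBlocks, List.range_succ, List.flatMap_append, List.length_append, Finset.sum_range_succ]
    push_cast
    rw [ih (by omega), List.flatMap_singleton, length_block (by omega) (by omega)]
    ring

/-- This relates the alternating sum in S(0) to the total length of the blocks between i_{2k} and
i_{2k+1}, which is what the degree of the first factor measures. -/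
lemma sum_alternating (ι : ℕ → ℤ) (t : ℕ) :
    ∑ l ∈ Finset.Ioc 0 (2 * t), (-1) ^ (0 + l + 1) * ι l =
      ∑ k ∈ Finset.range t, (ι (2 * k + 1) - ι (2 * k)) + ι 0 - ι (2 * t) := by
  induction t with
  | zero => simp
  | succ t ih =>
    rw [show 2 * (t + 1) = 2 * t + 1 + 1 by ring, Finset.sum_Ioc_succ_top (by omega),
      Finset.sum_Ioc_succ_top (by omega), ih, Finset.sum_range_succ,
      Even.neg_one_pow (⟨t + 1, by ring⟩ : Even (0 + (2 * t + 1) + 1)),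
      Odd.neg_one_pow (⟨t + 1, by ring⟩ : Odd (0 + (2 * t + 1 + 1) + 1))]
    ring

/-- For n even, the block between i_k and i_{k+1} has n - k cuts above it, an even number exactly
when k is even; the block after i_n has none. So this word deletes the complement of A. For n odd
the parities are reversed, and `oddLeft` deletes the complement of B. -/
lemma IsTuple.mem_evenLeft {t : ℕ} (h : IsTuple (2 * t) m ι) {v : ℕ} :
    v ∈ evenLeft (2 * t) m ι ↔ v ≤ m ∧ v ∉ entries ι (Finset.range (2 * t + 1)) ∧
      Even (up (entries ι (Finset.range (2 * t + 1))) v) := by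
  have h0 := h.nonneg (l := 2 * t) le_rfl
  rw [evenLeft, List.mem_append, show 2 * t / 2 = t by omega, h.mem_lowerBlocks (by omega),
    mem_block (by omega)]
  constructor
  · rintro (⟨k, hk, h1, h2⟩ | ⟨h1, h2⟩)
    · obtain ⟨a, b⟩ := h.up_of_between (by omega) h1 h2
      have := h.le (l := 2 * k + 1) (by omega)
      exact ⟨by omega, a, by rw [b]; exact ⟨t - k, by omega⟩⟩
    · obtain ⟨a, b⟩ := h.up_of_gt (v := v) (by omega)
      exact ⟨by omega, a, by rw [b]; exact Even.zero⟩
  · rintro ⟨hv, h1, h2⟩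
    rcases h.cases h1 with h3 | ⟨k, hk, h3, h4⟩ | h3
    · rw [(h.up_of_lt h3).2] at h2
      obtain ⟨r, hr⟩ := h2
      omega
    · rw [(h.up_of_between hk h3 h4).2] at h2
      obtain ⟨r, hr⟩ := h2
      obtain ⟨s, rfl⟩ : ∃ s, k = 2 * s := ⟨t - r, by omega⟩
      exact Or.inl ⟨s, by omega, h3, h4⟩
    · exact Or.inr ⟨by omega, by omega⟩

lemma IsTuple.mem_evenRight {t : ℕ} (h : IsTuple (2 * t) m ι) {v : ℕ} :
    v ∈ evenRight (2 * t) ι ↔ v ≤ m ∧ v ∉ entries ι (Finset.range (2 * t + 1)) ∧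
      Odd (up (entries ι (Finset.range (2 * t + 1))) v) := by
  have h0 := h.le (l := 0) (by omega)
  rw [evenRight, List.mem_append, show 2 * t / 2 = t by omega, h.mem_upperBlocks (by omega),
    mem_block le_rfl]
  constructor
  · rintro (⟨h1, h2⟩ | ⟨k, hk, h1, h2⟩)
    · obtain ⟨a, b⟩ := h.up_of_lt (v := v) (by omega)
      exact ⟨by omega, a, by rw [b]; exact ⟨t, rfl⟩⟩
    · obtain ⟨a, b⟩ := h.up_of_between (by omega) h1 h2
      have := h.le (l := 2 * k + 2) (by omega)
      exact ⟨by omega, a, by rw [b]; exact ⟨t - k - 1, by omega⟩⟩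
  · rintro ⟨hv, h1, h2⟩
    rcases h.cases h1 with h3 | ⟨k, hk, h3, h4⟩ | h3
    · exact Or.inl ⟨by omega, by omega⟩
    · rw [(h.up_of_between hk h3 h4).2] at h2
      obtain ⟨r, hr⟩ := h2
      obtain ⟨s, rfl⟩ : ∃ s, k = 2 * s + 1 := ⟨t - r - 1, by omega⟩
      exact Or.inr ⟨s, by omega, h3, h4⟩
    · rw [(h.up_of_gt h3).2] at h2
      obtain ⟨r, hr⟩ := h2
      omega

lemma IsTuple.mem_oddLeft {t : ℕ} (h : IsTuple (2 * t + 1) m ι) {v : ℕ} :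
    v ∈ oddLeft (2 * t + 1) ι ↔ v ≤ m ∧ v ∉ entries ι (Finset.range (2 * t + 1 + 1)) ∧
      Odd (up (entries ι (Finset.range (2 * t + 1 + 1))) v) := by
  rw [oddLeft, show (2 * t + 1 + 1) / 2 = t + 1 by omega, h.mem_lowerBlocks (by omega)]
  constructor
  · rintro ⟨k, hk, h1, h2⟩
    obtain ⟨a, b⟩ := h.up_of_between (by omega) h1 h2
    have := h.le (l := 2 * k + 1) (by omega)
    exact ⟨by omega, a, by rw [b]; exact ⟨t - k, by omega⟩⟩
  · rintro ⟨hv, h1, h2⟩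
    rcases h.cases h1 with h3 | ⟨k, hk, h3, h4⟩ | h3
    · rw [(h.up_of_lt h3).2] at h2
      obtain ⟨r, hr⟩ := h2
      omega
    · rw [(h.up_of_between hk h3 h4).2] at h2
      obtain ⟨r, hr⟩ := h2
      obtain ⟨s, rfl⟩ : ∃ s, k = 2 * s := ⟨t - r, by omega⟩
      exact ⟨s, by omega, h3, h4⟩
    · rw [(h.up_of_gt h3).2] at h2
      obtain ⟨r, hr⟩ := h2
      omega

lemma IsTuple.mem_oddRight {t : ℕ} (h : IsTuple (2 * t + 1) m ι) {v : ℕ} :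
    v ∈ oddRight (2 * t + 1) m ι ↔ v ≤ m ∧ v ∉ entries ι (Finset.range (2 * t + 1 + 1)) ∧
      Even (up (entries ι (Finset.range (2 * t + 1 + 1))) v) := by
  have h0 := h.le (l := 0) (by omega)
  have h0' := h.nonneg (l := 2 * t + 1) le_rfl
  rw [oddRight, List.mem_append, List.mem_append, show (2 * t + 1 - 1) / 2 = t by omega,
    h.mem_upperBlocks (by omega), mem_block le_rfl, mem_block (by omega)]
  constructor
  · rintro ((⟨h1, h2⟩ | ⟨k, hk, h1, h2⟩) | ⟨h1, h2⟩)
    · obtain ⟨a, b⟩ := h.up_of_lt (v := v) (by omega)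
      exact ⟨by omega, a, by rw [b]; exact ⟨t + 1, by ring⟩⟩
    · obtain ⟨a, b⟩ := h.up_of_between (by omega) h1 h2
      have := h.le (l := 2 * k + 2) (by omega)
      exact ⟨by omega, a, by rw [b]; exact ⟨t - k, by omega⟩⟩
    · obtain ⟨a, b⟩ := h.up_of_gt (v := v) (by omega)
      exact ⟨by omega, a, by rw [b]; exact Even.zero⟩
  · rintro ⟨hv, h1, h2⟩
    rcases h.cases h1 with h3 | ⟨k, hk, h3, h4⟩ | h3
    · exact Or.inl (Or.inl ⟨by omega, by omega⟩)
    · rw [(h.up_of_between hk h3 h4).2] at h2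
      obtain ⟨r, hr⟩ := h2
      obtain ⟨s, rfl⟩ : ∃ s, k = 2 * s + 1 := ⟨t - r, by omega⟩
      exact Or.inl (Or.inr ⟨s, by omega, h3, h4⟩)
    · exact Or.inr ⟨by omega, by omega⟩

lemma IsTuple.pairwise_evenLeft {t : ℕ} (h : IsTuple (2 * t) m ι) :
    (evenLeft (2 * t) m ι).Pairwise (· < ·) := by
  have h0 := h.nonneg (l := 2 * t) le_rfl
  rw [evenLeft, List.pairwise_append, show 2 * t / 2 = t by omega]
  refine ⟨h.pairwise_lowerBlocks (by omega), pairwise_block _ _, fun x hx y hy => ?_⟩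
  obtain ⟨k, hk, h1, h2⟩ := (h.mem_lowerBlocks (by omega)).1 hx
  rw [mem_block (by omega)] at hy
  have := h.lt (l := 2 * k + 1) (l' := 2 * t) (by omega) le_rfl
  omega

lemma IsTuple.pairwise_evenRight {t : ℕ} (h : IsTuple (2 * t) m ι) :
    (evenRight (2 * t) ι).Pairwise (· < ·) := by
  rw [evenRight, List.pairwise_append, show 2 * t / 2 = t by omega]
  refine ⟨pairwise_block _ _, h.pairwise_upperBlocks (by omega), fun x hx y hy => ?_⟩
  obtain ⟨k, hk, h1, h2⟩ := (h.mem_upperBlocks (by omega)).1 hy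
  rw [mem_block le_rfl] at hx
  have := h.lt (l := 0) (l' := 2 * k + 1) (by omega) (by omega)
  omega

lemma IsTuple.pairwise_oddLeft {t : ℕ} (h : IsTuple (2 * t + 1) m ι) :
    (oddLeft (2 * t + 1) ι).Pairwise (· < ·) := by
  rw [oddLeft, show (2 * t + 1 + 1) / 2 = t + 1 by omega]
  exact h.pairwise_lowerBlocks (by omega)

lemma IsTuple.pairwise_oddRight {t : ℕ} (h : IsTuple (2 * t + 1) m ι) :
    (oddRight (2 * t + 1) m ι).Pairwise (· < ·) := by
  have h0 := h.nonneg (l := 2 * t + 1) le_rfl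
  rw [oddRight, List.pairwise_append, List.pairwise_append, show (2 * t + 1 - 1) / 2 = t by omega]
  refine ⟨⟨pairwise_block _ _, h.pairwise_upperBlocks (by omega), fun x hx y hy => ?_⟩,
    pairwise_block _ _, fun x hx y hy => ?_⟩
  · obtain ⟨k, hk, h1, h2⟩ := (h.mem_upperBlocks (by omega)).1 hy
    rw [mem_block le_rfl] at hx
    have := h.lt (l := 0) (l' := 2 * k + 1) (by omega) (by omega)
    omega
  · rw [mem_block (by omega)] at hy
    rcases List.mem_append.1 hx with hx | hx
    · rw [mem_block le_rfl] at hx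
      have := h.lt (l := 0) (l' := 2 * t + 1) (by omega) le_rfl
      omega
    · obtain ⟨k, hk, h1, h2⟩ := (h.mem_upperBlocks (by omega)).1 hx
      have := h.lt (l := 2 * k + 2) (l' := 2 * t + 1) (by omega) le_rfl
      omega

end Words

/-! ### Assembling the explicit formula -/

section Formula

variable {X : SSet.{u}} {j : ℕ} {n m : ℕ} {ι : ℕ → ℤ}

/-- A word avoiding a cut leaves at least one vertex, so no letter acts on a simplex of degree 0,
where `face` does nothing by default. -/
lemma length_le_of_notMem {w : List ℕ} (hw : w.Pairwise (· < ·)) (hb : ∀ v ∈ w, v ≤ m) {i : ℕ}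
    (hi : i ≤ m) (hiw : i ∉ w) : w.length ≤ m := by
  have h1 : w.toFinset ⊆ (Finset.range (m + 1)).erase i := fun v hv => by
    rw [List.mem_toFinset] at hv
    have := hb v hv
    exact Finset.mem_erase.2 ⟨fun e => hiw (e ▸ hv), Finset.mem_range.2 (by omega)⟩
  have h2 := Finset.card_le_card h1
  rwa [List.toFinset_card_of_nodup (hw.imp fun h => ne_of_lt h),
    Finset.card_erase_of_mem (Finset.mem_range.2 (by omega)), Finset.card_range,
    Nat.add_sub_cancel] at h2

lemma ev_faces_vertsA (c : NCochain (ZMod 2) X j) (y : X _⦋m⦌) {I : Finset ℕ} {i : ℕ} (hi : i ∈ I)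
    (him : i ≤ m) {w : List ℕ} (hw : w.Pairwise (· < ·))
    (hmem : ∀ v, v ∈ w ↔ v ≤ m ∧ v ∉ I ∧ Even (up I v)) :
    ev c (faces w ⟨m, y⟩) = evOn c y (vertsA m I) := by
  have hb : ∀ v ∈ w, v ≤ m := fun v hv => ((hmem v).1 hv).1
  rw [ev_faces_sorted c y w hw hb
    (length_le_of_notMem hw hb him fun h => ((hmem i).1 h).2.1 hi)]
  congr 1
  ext v
  rw [Finset.mem_sdiff, List.mem_toFinset, hmem, mem_vertsA, Finset.mem_range, Nat.lt_succ_iff,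
    ← Nat.not_even_iff_odd]
  tauto

lemma ev_faces_vertsB (c : NCochain (ZMod 2) X j) (y : X _⦋m⦌) {I : Finset ℕ} {i : ℕ} (hi : i ∈ I)
    (him : i ≤ m) {w : List ℕ} (hw : w.Pairwise (· < ·))
    (hmem : ∀ v, v ∈ w ↔ v ≤ m ∧ v ∉ I ∧ Odd (up I v)) :
    ev c (faces w ⟨m, y⟩) = evOn c y (vertsB m I) := by
  have hb : ∀ v ∈ w, v ≤ m := fun v hv => ((hmem v).1 hv).1
  rw [ev_faces_sorted c y w hw hb
    (length_le_of_notMem hw hb him fun h => ((hmem i).1 h).2.1 hi)]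
  congr 1
  ext v
  rw [Finset.mem_sdiff, List.mem_toFinset, hmem, mem_vertsB, Finset.mem_range, Nat.lt_succ_iff,
    ← Nat.not_even_iff_odd]
  tauto

/-- A cochain of degree j sees only faces of dimension j. This length count is the source of the
condition i_0 = S(0). -/
lemma length_of_ev_ne_zero (c : NCochain (ZMod 2) X j) (y : X _⦋m⦌) {w : List ℕ}
    (hw : w.Pairwise (· < ·)) (hb : ∀ v ∈ w, v ≤ m) {i : ℕ} (hi : i ≤ m) (hiw : i ∉ w)
    (h : ev c (faces w ⟨m, y⟩) ≠ 0) : w.length + j = m := by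
  have hl := (isPull_faces_sorted y w hw hb (length_le_of_notMem hw hb hi hiw)).1
  rw [ev_eq_evOn] at h
  by_contra hne
  refine h (evOn_eq_zero_of_card c _ ?_)
  rw [Finset.card_range]
  omega

lemma nestedSum_even (c : NCochain (ZMod 2) X j) {i t : ℕ} (hij : i + 2 * t = j)
    (hm : m = i + j) (y : X _⦋m⦌) :
    nestedSum (2 * t) m (fun ι => ev c (faces (evenLeft (2 * t) m ι) ⟨m, y⟩) *
        ev c (faces (evenRight (2 * t) ι) ⟨m, y⟩)) =
      ∑ I ∈ (Finset.range (m + 1)).powersetCard (2 * t + 1),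
        evOn c y (vertsA m I) * evOn c y (vertsB m I) := by
  refine nestedSum_eq (by omega) (T := fun I => evOn c y (vertsA m I) * evOn c y (vertsB m I))
    (fun ι h => ?_) (fun ι h hne => ?_)
  · have hle := h.le (l := 0) (by omega)
    have hnn := h.nonneg (l := 0) (by omega)
    have hmem : (ι 0).toNat ∈ entries ι (Finset.range (2 * t + 1)) :=
      h.mem_entries.2 ⟨0, by omega, by omega⟩
    rw [ev_faces_vertsA c y hmem (by omega) h.pairwise_evenLeft fun v => h.mem_evenLeft,
      ev_faces_vertsB c y hmem (by omega) h.pairwise_evenRight fun v => h.mem_evenRight]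
  · have hle := h.le (l := 0) (by omega)
    have hnn := h.nonneg (l := 0) (by omega)
    have hmem : (ι 0).toNat ∈ entries ι (Finset.range (2 * t + 1)) :=
      h.mem_entries.2 ⟨0, by omega, by omega⟩
    -- The word has length m - j = i. Together with the block lengths and (m + 1)/2 = i + t, this is
    -- exactly i_0 = S(0). The second factor is not needed.
    have hl := length_of_ev_ne_zero c y h.pairwise_evenLeft (fun v hv => (h.mem_evenLeft.1 hv).1)
      (by omega) (fun hv => (h.mem_evenLeft.1 hv).2.1 hmem) (left_ne_zero_of_mul hne)
    have h1 := h.nonneg (l := 2 * t) le_rfl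
    have h2 := h.le (l := 2 * t) le_rfl
    rw [evenLeft, List.length_append, show 2 * t / 2 = t by omega] at hl
    have h3 := h.length_lowerBlocks (t := t) (by omega)
    have h4 := length_block (a := ι (2 * t) + 1) (b := m) (by omega) (by omega)
    have h5 := sum_alternating ι t
    rw [lowerBound, h5, Even.neg_one_pow ⟨t, by ring⟩]
    have h6 : (m + 1) / 2 = i + t := by omega
    rw [h6]
    simp only [Nat.zero_div]
    zify at hl
    rw [h3, h4] at hl
    push_cast
    have h7 : (m : ℤ) = i + j := by omega
    have h8 : (i : ℤ) + 2 * t = j := by omega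
    linarith

lemma nestedSum_odd (c : NCochain (ZMod 2) X j) {i t : ℕ} (hij : i + (2 * t + 1) = j)
    (hm : m = i + j) (y : X _⦋m⦌) :
    nestedSum (2 * t + 1) m (fun ι => ev c (faces (oddLeft (2 * t + 1) ι) ⟨m, y⟩) *
        ev c (faces (oddRight (2 * t + 1) m ι) ⟨m, y⟩)) =
      ∑ I ∈ (Finset.range (m + 1)).powersetCard (2 * t + 1 + 1),
        evOn c y (vertsA m I) * evOn c y (vertsB m I) := by
  refine nestedSum_eq (by omega) (T := fun I => evOn c y (vertsA m I) * evOn c y (vertsB m I))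
    (fun ι h => ?_) (fun ι h hne => ?_)
  · have hle := h.le (l := 0) (by omega)
    have hnn := h.nonneg (l := 0) (by omega)
    have hmem : (ι 0).toNat ∈ entries ι (Finset.range (2 * t + 1 + 1)) :=
      h.mem_entries.2 ⟨0, by omega, by omega⟩
    -- For n odd the first factor is the B-side, so the two factors appear in the opposite order.
    rw [ev_faces_vertsB c y hmem (by omega) h.pairwise_oddLeft fun v => h.mem_oddLeft,
      ev_faces_vertsA c y hmem (by omega) h.pairwise_oddRight fun v => h.mem_oddRight, mul_comm]
  · have hle := h.le (l := 0) (by omega)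
    have hnn := h.nonneg (l := 0) (by omega)
    have hmem : (ι 0).toNat ∈ entries ι (Finset.range (2 * t + 1 + 1)) :=
      h.mem_entries.2 ⟨0, by omega, by omega⟩
    have hl := length_of_ev_ne_zero c y h.pairwise_oddLeft (fun v hv => (h.mem_oddLeft.1 hv).1)
      (by omega) (fun hv => (h.mem_oddLeft.1 hv).2.1 hmem) (left_ne_zero_of_mul hne)
    rw [oddLeft, show (2 * t + 1 + 1) / 2 = t + 1 by omega] at hl
    have h3 := h.length_lowerBlocks (t := t + 1) (by omega)
    rw [Finset.sum_range_succ] at h3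
    have h5 := sum_alternating ι t
    rw [lowerBound, Finset.sum_Ioc_succ_top (by omega), h5,
      Even.neg_one_pow (⟨t + 1, by ring⟩ : Even (0 + (2 * t + 1) + 1)),
      Odd.neg_one_pow (⟨t, by ring⟩ : Odd (0 + (2 * t + 1)))]
    -- Here m = 2i + 2t + 1 is odd, so the floor in S(0) rounds nothing.
    have h6 : (m + 1) / 2 = i + t + 1 := by omega
    rw [h6]
    simp only [Nat.zero_div]
    zify at hl
    rw [h3] at hl
    push_cast at hl ⊢
    have h7 : (m : ℤ) = i + j := by omega
    have h8 : (i : ℤ) + (2 * t + 1) = j := by omega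
    linarith

/-- This is the closed form of `shihEval_mk` on the diagonal simplex y × y, with n = j - i; the
degrees agree because (i + j) + (j - i) = 2j. -/
lemma Sq_mk_single {i : ℕ} (hij : i ≤ j) (c : NCochain (ZMod 2) X j) (y : X _⦋i + j⦌) :
    Sq i c (NChain.mk (ZMod 2) X (i + j) (Finsupp.single y 1)) =
      ∑ I ∈ (Finset.range (i + j + 1)).powersetCard (j - i + 1),
        evOn c y (vertsA (i + j) I) * evOn c y (vertsB (i + j) I) := by
  rw [Sq, if_pos hij, ← LinearMap.comp_assoc, ← LinearMap.comp_assoc, LinearMap.comp_apply]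
  change (shihEval c 0 (i + j + (j - i)) ∘ₗ tSHIPow (ZMod 2) X (i + j) (j - i)) _ = _
  rw [shihEval_comp_tSHIPow, zero_add, diag, NChain.map, NChain.desc_mk_single, one_smul]
  exact shihEval_mk c (by omega) (pairing y y)

/-- A cochain is determined by its values on the simplices. -/
lemma apply_mk_eq_sum {k : ℕ} (f : NCochain (ZMod 2) X k) (g : X _⦋k⦌ → ZMod 2)
    (h : ∀ y, f (NChain.mk (ZMod 2) X k (Finsupp.single y 1)) = g y) (x : X _⦋k⦌ →₀ ZMod 2) :
    f (NChain.mk (ZMod 2) X k x) = x.sum fun y r => r * g y := by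
  induction x using Finsupp.induction_linear with
  | zero => simp
  | add x x' hx hx' =>
    rw [map_add, map_add, hx, hx', Finsupp.sum_add_index' (by simp) (by intros; ring)]
  | single y r =>
    rw [Finsupp.sum_single_index (by simp), ← h, ← smul_eq_mul, ← map_smul, ← map_smul,
      Finsupp.smul_single_one]

end Formula

end SteenrodSquare

end

theorem corollary3p2 (X : SSet.{u}) (i j : ℕ) (c : SteenrodSquare.NCochain (ZMod 2) X j) :
    (i ≤ j → Even (i + j) → ∀ x : X _⦋i + j⦌ →₀ ZMod 2,
      SteenrodSquare.Sq i c (SteenrodSquare.NChain.mk (ZMod 2) X (i + j) x) =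
        x.sum fun y r => r * SteenrodSquare.nestedSum (j - i) (i + j) fun ι =>
          SteenrodSquare.ev c (SteenrodSquare.faces
              (SteenrodSquare.evenLeft (j - i) (i + j) ι) ⟨i + j, y⟩) *
            SteenrodSquare.ev c (SteenrodSquare.faces
              (SteenrodSquare.evenRight (j - i) ι) ⟨i + j, y⟩)) ∧
    (i ≤ j → Odd (i + j) → ∀ x : X _⦋i + j⦌ →₀ ZMod 2,
      SteenrodSquare.Sq i c (SteenrodSquare.NChain.mk (ZMod 2) X (i + j) x) =
        x.sum fun y r => r * SteenrodSquare.nestedSum (j - i) (i + j) fun ι =>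
          SteenrodSquare.ev c (SteenrodSquare.faces
              (SteenrodSquare.oddLeft (j - i) ι) ⟨i + j, y⟩) *
            SteenrodSquare.ev c (SteenrodSquare.faces
              (SteenrodSquare.oddRight (j - i) (i + j) ι) ⟨i + j, y⟩)) ∧
    (j < i → SteenrodSquare.Sq i c = 0) := by
  refine ⟨fun hij hm x => ?_, fun hij hm x => ?_, fun hij => if_neg (by omega)⟩
  · refine SteenrodSquare.apply_mk_eq_sum _ _ (fun y => ?_) x
    obtain ⟨s, hs⟩ := hm
    obtain ⟨t, ht⟩ : ∃ t, j - i = 2 * t := ⟨s - i, by omega⟩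
    rw [SteenrodSquare.Sq_mk_single hij, ht]
    exact (SteenrodSquare.nestedSum_even c (by omega) rfl y).symm
  · refine SteenrodSquare.apply_mk_eq_sum _ _ (fun y => ?_) x
    obtain ⟨s, hs⟩ := hm
    obtain ⟨t, ht⟩ : ∃ t, j - i = 2 * t + 1 := ⟨s - i, by omega⟩
    rw [SteenrodSquare.Sq_mk_single hij, ht]
    exact (SteenrodSquare.nestedSum_odd c (by omega) rfl y).symm
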